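/- Let $(\mathcal B,\mathbb E,\mathfrak s)$ be an extriangulated category in the sense of Nakaoka–Palu: $\mathcal B$ is an additive category, $\mathbb E\colon\mathcal B^{\mathrm{op}}\times\mathcal B\to\mathrm{Ab}$ is an additive bifunctor, and $\mathfrak s$ is an additive realization, assigning to each $\delta\in\mathbb E(C,A)$ an equivalence class of sequences $A\to B\to C$, such that (ET3), (ET3)$^{\mathrm{op}}$, (ET4), (ET4)$^{\mathrm{op}}$ hold. A sequence $A\to B\to C$ is called a conflation if it realizes some $\delta\in\mathbb E(C,A)$. A cotorsion pair $(\mathcal U,\mathcal V)$ on $\mathcal B$ consists of two full additive subcategories, closed under isomorphisms and direct summands, such that $\mathbb E(\mathcal U,\mathcal V)=0$ and every $B\in\mathcal B$ admits conflations $V_B\to U_B\to B$ and $B\to V^B\to U^B$ with $U_B,U^B\in\mathcal U$ and $V_B,V^B\in\mathcal V$. Put $\mathcal W=\mathcal U\cap\mathcal V$. Let $\mathcal B^+$ be the full subcategory of those $B$ which admit a conflation $V\to W\to B$ with $V\in\mathcal V$, $W\in\mathcal W$, and let $\mathcal B^-$ be the full subcategory of those $B$ which admit a conflation $B\to W\to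 U$ with $W\in\mathcal W$, $U\in\mathcal U$. Let $\pi\colon\mathcal B\to\underline{\mathcal B}=\mathcal B/\mathcal W$ be the quotient by the ideal of morphisms which factor through objects of $\mathcal W$, and let $\underline{\mathcal B}^{+}$, $\underline{\mathcal B}^{-}$ be the full subcategories of $\underline{\mathcal B}$ on the objects of $\mathcal B^{+}$, $\mathcal B^{-}$. The heart $\underline{\mathcal H}$ of $(\mathcal U,\mathcal V)$ is the full subcategory of $\underline{\mathcal B}$ on the objects of $\mathcal B^+\cap\mathcal B^-$. The inclusion $\underline{\mathcal B}^+\hookrightarrow\underline{\mathcal B}$ has a left adjoint $\sigma^+$, given on objects by reflection sequences: conflations $B\to B^+\to S$ with $B^+\in\mathcal B^+$, $S\in\mathcal U$ and $\mathbb E(B^+,V)\to\mathbb E(B,V)$ surjective for all $V\in\mathcal V$. Dually, $\underline{\mathcal B}^-\hookrightarrow\underline{\mathcal B}$ has a right adjoint $\sigma^-$. The associated functor is $H=\sigma^-\circ\sigma^+\circ\pi\colon\mathcal B\to\underline{\mathcal H}$. The kernel of $(\mathcal U,\mathcal V)$ is $\mathcal K=\mathrm{add}(\mathcal U*\mathcal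 V)$, where $\mathcal U*\mathcal V$ consists of the objects $X$ which admit a conflation $U\to X\to V$ with $U\in\mathcal U$, $V\in\mathcal V$, and $\mathrm{add}$ denotes the closure under direct summands in $\mathcal B$. Let $(\mathcal U,\mathcal V)$ and $(\mathcal U',\mathcal V')$ be arbitrary cotorsion pairs on $\mathcal B$, with hearts $\underline{\mathcal H},\underline{\mathcal H}'$, associated functors $H,H'$ and kernels $\mathcal K,\mathcal K'$. Then the following are equivalent. 1. $(\mathcal U,\mathcal V)$ and $(\mathcal U',\mathcal V')$ are heart-equivalent, i.e. there is an equivalence of categories $E\colon\underline{\mathcal H}\to\underline{\mathcal H}'$ such that $E\circ H$ is naturally isomorphic to $H'$. 2. $H'(\mathcal U)=H'(\mathcal V)=0$ and $H(\mathcal U')=H(\mathcal V')=0$. 3. $\mathcal K=\mathcal K'$. -/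

import Mathlib

open CategoryTheory CategoryTheory.Limits Opposite

universe w v u

noncomputable section

namespace ExtriCat

/-! ### Sequences `A ⟶ B ⟶ C` up to equivalence -/

/-- A sequence of morphisms `A ⟶ mid ⟶ C` with fixed end terms. -/
structure TwoSeq {𝓑 : Type u} [Category.{v} 𝓑] (A C : 𝓑) where
  mid : 𝓑
  fst : A ⟶ mid
  snd : mid ⟶ C

/-- Two sequences with the same ends are equivalent if there is an isomorphism between the middle
terms which is compatible with the morphisms. -/
def TwoSeq.Equiv {𝓑 : Type u} [Category.{v} 𝓑] {A C : 𝓑} (S T : TwoSeq A C) : Prop :=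
  ∃ b : S.mid ≅ T.mid, S.fst ≫ b.hom = T.fst ∧ b.hom ≫ T.snd = S.snd

instance TwoSeq.setoid {𝓑 : Type u} [Category.{v} 𝓑] (A C : 𝓑) : Setoid (TwoSeq A C) where
  r := TwoSeq.Equiv
  iseqv :=
    { refl := fun S => ⟨Iso.refl _, by simp, by simp⟩
      symm := by
        rintro S T ⟨b, h₁, h₂⟩
        exact ⟨b.symm, by simp [← h₁], by simp [← h₂]⟩
      trans := by
        rintro S T R ⟨b, h₁, h₂⟩ ⟨b', h₁', h₂'⟩
        exact ⟨b ≪≫ b', by simp [← h₁, ← h₁'], by simp [← h₂, ← h₂']⟩ }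

/-- Equivalence classes of sequences `A ⟶ B ⟶ C`. -/
abbrev SeqClass {𝓑 : Type u} [Category.{v} 𝓑] (A C : 𝓑) := _root_.Quotient (TwoSeq.setoid A C)

/-! ### Extriangulated categories -/

/-- An additive bifunctor `𝔼 : 𝓑ᵒᵖ × 𝓑 → Ab`, together with a correspondence `s` which sends every
extension `δ ∈ 𝔼(C, A)` to an equivalence class of sequences `A ⟶ B ⟶ C`. -/
structure ExtStructure (𝓑 : Type u) [Category.{v} 𝓑] [Preadditive 𝓑] where
  E : 𝓑ᵒᵖ ⥤ 𝓑 ⥤ AddCommGrpCat.{w}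
  additive_left : ∀ A : 𝓑, (E.flip.obj A).Additive
  additive_right : ∀ C : 𝓑ᵒᵖ, (E.obj C).Additive
  s : ∀ {C A : 𝓑}, ((E.obj (op C)).obj A) → SeqClass A C

namespace ExtStructure

variable {𝓑 : Type u} [Category.{v} 𝓑] [Preadditive 𝓑] (X : ExtStructure.{w} 𝓑)

/-- The group `𝔼(C, A)` of extensions. -/
abbrev Ext (C A : 𝓑) : Type w := (X.E.obj (op C)).obj A

/-- `a_* δ` -/
def push {C A A' : 𝓑} (a : A ⟶ A') (δ : X.Ext C A) : X.Ext C A' :=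
  (X.E.obj (op C)).map a δ

/-- `c^* δ` -/
def pull {C C' A : 𝓑} (c : C' ⟶ C) (δ : X.Ext C A) : X.Ext C' A :=
  (X.E.map c.op).app A δ

/-- The sequence `A ⟶ B ⟶ C` realizes `δ`, i.e. `A ⟶ B ⟶ C ⇢ δ` is an `𝔼`-triangle. -/
def Realizes {A B C : 𝓑} (x : A ⟶ B) (y : B ⟶ C) (δ : X.Ext C A) : Prop :=
  X.s δ = ⟦⟨B, x, y⟩⟧

/-- `A ⟶ B ⟶ C` is a conflation. -/
def Conflation {A B C : 𝓑} (x : A ⟶ B) (y : B ⟶ C) : Prop :=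
  ∃ δ : X.Ext C A, X.Realizes x y δ

/-- `δ ⊕ δ'`: the extension in `𝔼(C ⊞ C', A ⊞ A')` with components `(δ, 0, 0, δ')`. -/
def dsum [HasBinaryBiproducts 𝓑] {A C A' C' : 𝓑} (δ : X.Ext C A) (δ' : X.Ext C' A') :
    X.Ext (C ⊞ C') (A ⊞ A') :=
  X.pull biprod.fst (X.push biprod.inl δ) + X.pull biprod.snd (X.push biprod.inr δ')

end ExtStructure

/-- An extriangulated category `(𝓑, 𝔼, s)`: the axioms (ET2), (ET3), (ET3)ᵒᵖ, (ET4), (ET4)ᵒᵖ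
((ET1) is part of `ExtStructure`). -/
structure ExtriangulatedCategory (𝓑 : Type u) [Category.{v} 𝓑] [Preadditive 𝓑]
    [HasZeroObject 𝓑] [HasBinaryBiproducts 𝓑] extends ExtStructure.{w} 𝓑 where
  /-- `s` is a realization: morphisms of extensions are realized. -/
  realize : ∀ {A B C A' B' C' : 𝓑} {x : A ⟶ B} {y : B ⟶ C} {x' : A' ⟶ B'} {y' : B' ⟶ C'}
    {δ : toExtStructure.Ext C A} {δ' : toExtStructure.Ext C' A'},
    toExtStructure.Realizes x y δ → toExtStructure.Realizes x' y' δ' →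
    ∀ (a : A ⟶ A') (c : C ⟶ C'), toExtStructure.push a δ = toExtStructure.pull c δ' →
      ∃ b : B ⟶ B', x ≫ b = a ≫ x' ∧ y ≫ c = b ≫ y'
  /-- the realization is additive (i): `s(0) = 0`. -/
  realize_zero : ∀ A C : 𝓑, toExtStructure.Realizes
    (biprod.inl : A ⟶ A ⊞ C) (biprod.snd : A ⊞ C ⟶ C) (0 : toExtStructure.Ext C A)
  /-- the realization is additive (ii): `s(δ ⊕ δ') = s(δ) ⊕ s(δ')`. -/
  realize_dsum : ∀ {A B C A' B' C' : 𝓑} {x : A ⟶ B} {y : B ⟶ C} {x' : A' ⟶ B'} {y' : B' ⟶ C'}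
    {δ : toExtStructure.Ext C A} {δ' : toExtStructure.Ext C' A'},
    toExtStructure.Realizes x y δ → toExtStructure.Realizes x' y' δ' →
    toExtStructure.Realizes (biprod.map x x') (biprod.map y y') (toExtStructure.dsum δ δ')
  et3 : ∀ {A B C A' B' C' : 𝓑} {x : A ⟶ B} {y : B ⟶ C} {x' : A' ⟶ B'} {y' : B' ⟶ C'}
    {δ : toExtStructure.Ext C A} {δ' : toExtStructure.Ext C' A'},
    toExtStructure.Realizes x y δ → toExtStructure.Realizes x' y' δ' →
    ∀ (a : A ⟶ A') (b : B ⟶ B'), x ≫ b = a ≫ x' →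
      ∃ c : C ⟶ C', toExtStructure.push a δ = toExtStructure.pull c δ' ∧ y ≫ c = b ≫ y'
  et3op : ∀ {A B C A' B' C' : 𝓑} {x : A ⟶ B} {y : B ⟶ C} {x' : A' ⟶ B'} {y' : B' ⟶ C'}
    {δ : toExtStructure.Ext C A} {δ' : toExtStructure.Ext C' A'},
    toExtStructure.Realizes x y δ → toExtStructure.Realizes x' y' δ' →
    ∀ (b : B ⟶ B') (c : C ⟶ C'), y ≫ c = b ≫ y' →
      ∃ a : A ⟶ A', toExtStructure.push a δ = toExtStructure.pull c δ' ∧ x ≫ b = a ≫ x'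
  et4 : ∀ {A B D C F : 𝓑} {f : A ⟶ B} {f' : B ⟶ D} {g : B ⟶ C} {g' : C ⟶ F}
    {δ : toExtStructure.Ext D A} {δ' : toExtStructure.Ext F B},
    toExtStructure.Realizes f f' δ → toExtStructure.Realizes g g' δ' →
    ∃ (E' : 𝓑) (h' : C ⟶ E') (d : D ⟶ E') (e : E' ⟶ F) (δ'' : toExtStructure.Ext E' A),
      g ≫ h' = f' ≫ d ∧ h' ≫ e = g' ∧
      toExtStructure.Realizes (f ≫ g) h' δ'' ∧
      toExtStructure.Realizes d e (toExtStructure.push f' δ') ∧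
      toExtStructure.pull d δ'' = δ ∧
      toExtStructure.push f δ'' = toExtStructure.pull e δ'
  et4op : ∀ {D A B F C : 𝓑} {f' : D ⟶ A} {f : A ⟶ B} {g' : F ⟶ B} {g : B ⟶ C}
    {δ : toExtStructure.Ext B D} {δ' : toExtStructure.Ext C F},
    toExtStructure.Realizes f' f δ → toExtStructure.Realizes g' g δ' →
    ∃ (E' : 𝓑) (h' : E' ⟶ A) (d : D ⟶ E') (e : E' ⟶ F) (δ'' : toExtStructure.Ext C E'),
      d ≫ h' = f' ∧ h' ≫ f = e ≫ g' ∧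
      toExtStructure.Realizes h' (f ≫ g) δ'' ∧
      toExtStructure.Realizes d e (toExtStructure.pull g' δ) ∧
      toExtStructure.push e δ'' = δ' ∧
      toExtStructure.push d δ = toExtStructure.pull g δ''

namespace ExtriangulatedCategory

variable {𝓑 : Type u} [Category.{v} 𝓑] [Preadditive 𝓑] [HasZeroObject 𝓑] [HasBinaryBiproducts 𝓑]
  (X : ExtriangulatedCategory.{w} 𝓑)

/-! Elementary facts on extensions. -/

lemma push_zero' {C A A' : 𝓑} (a : A ⟶ A') : X.push a (0 : X.Ext C A) = 0 := map_zero _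
lemma pull_zero' {C C' A : 𝓑} (c : C' ⟶ C) : X.pull c (0 : X.Ext C A) = 0 := map_zero _
lemma push_sub' {C A A' : 𝓑} (a : A ⟶ A') (δ ε : X.Ext C A) :
    X.push a (δ - ε) = X.push a δ - X.push a ε := map_sub _ _ _
lemma pull_sub' {C C' A : 𝓑} (c : C' ⟶ C) (δ ε : X.Ext C A) :
    X.pull c (δ - ε) = X.pull c δ - X.pull c ε := map_sub _ _ _
lemma push_id {C A : 𝓑} (δ : X.Ext C A) : X.push (𝟙 A) δ = δ := by
  simp [ExtStructure.push]
lemma pull_id {C A : 𝓑} (δ : X.Ext C A) : X.pull (𝟙 C) δ = δ := by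
  simp [ExtStructure.pull]
lemma push_comp {C A A' A'' : 𝓑} (a : A ⟶ A') (a' : A' ⟶ A'') (δ : X.Ext C A) :
    X.push (a ≫ a') δ = X.push a' (X.push a δ) := by
  simp [ExtStructure.push]
lemma pull_comp {C C' C'' A : 𝓑} (c : C' ⟶ C) (c' : C'' ⟶ C') (δ : X.Ext C A) :
    X.pull (c' ≫ c) δ = X.pull c' (X.pull c δ) := by
  simp [ExtStructure.pull]
lemma push_pull {C C' A A' : 𝓑} (a : A ⟶ A') (c : C' ⟶ C) (δ : X.Ext C A) :
    X.push a (X.pull c δ) = X.pull c (X.push a δ) :=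
  (ConcreteCategory.congr_hom ((X.E.map c.op).naturality a) δ).symm
lemma pull_zero_hom {C C' A : 𝓑} (δ : X.Ext C A) : X.pull (0 : C' ⟶ C) δ = 0 := by
  have := X.additive_left A
  have h := (X.E.flip.obj A).map_zero (op C) (op C')
  exact ConcreteCategory.congr_hom h δ
lemma push_zero_hom {C A A' : 𝓑} (δ : X.Ext C A) : X.push (0 : A ⟶ A') δ = 0 := by
  have := X.additive_right (op C)
  have h := (X.E.obj (op C)).map_zero A A'
  exact ConcreteCategory.congr_hom h δ
lemma pull_sub_hom {C C' A : 𝓑} (c c' : C' ⟶ C) (δ : X.Ext C A) :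
    X.pull (c - c') δ = X.pull c δ - X.pull c' δ := by
  have := X.additive_left A
  have h := (X.E.flip.obj A).map_sub (f := c.op) (g := c'.op)
  exact ConcreteCategory.congr_hom h δ
lemma push_sub_hom {C A A' : 𝓑} (a a' : A ⟶ A') (δ : X.Ext C A) :
    X.push (a - a') δ = X.push a δ - X.push a' δ := by
  have := X.additive_right (op C)
  have h := (X.E.obj (op C)).map_sub (f := a) (g := a')
  exact ConcreteCategory.congr_hom h δ

lemma exists_realizes {C A : 𝓑} (δ : X.Ext C A) :
    ∃ (B : 𝓑) (x : A ⟶ B) (y : B ⟶ C), X.Realizes x y δ := by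
  obtain ⟨⟨B, x, y⟩, h⟩ := _root_.Quotient.exists_rep (X.s δ)
  exact ⟨B, x, y, h.symm⟩

variable {X}

lemma realizes_of_iso {A B B' C : 𝓑} {x : A ⟶ B} {y : B ⟶ C} {δ : X.Ext C A}
    (h : X.Realizes x y δ) (e : B ≅ B') : X.Realizes (x ≫ e.hom) (e.inv ≫ y) δ :=
  h.trans (_root_.Quotient.sound ⟨e, rfl, by simp⟩)

lemma realizes_iso {A B B' C : 𝓑} {x : A ⟶ B} {y : B ⟶ C} {x' : A ⟶ B'} {y' : B' ⟶ C}
    {δ : X.Ext C A} (h : X.Realizes x y δ) (h' : X.Realizes x' y' δ) :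
    ∃ e : B ≅ B', x ≫ e.hom = x' ∧ e.hom ≫ y' = y :=
  _root_.Quotient.exact (h.symm.trans h')

lemma realizes_id_zero (A : 𝓑) {Z : 𝓑} (hZ : IsZero Z) :
    X.Realizes (𝟙 A) (0 : A ⟶ Z) (0 : X.Ext Z A) := by
  refine (X.realize_zero A Z).trans (_root_.Quotient.sound
    ⟨{ hom := biprod.fst
       inv := biprod.inl
       hom_inv_id := ?_ }, ?_, ?_⟩)
  · apply biprod.hom_ext'
    · simp
    · exact hZ.eq_of_src _ _
  · simp
  · exact hZ.eq_of_tgt _ _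

lemma realizes_zero_id (C : 𝓑) {Z : 𝓑} (hZ : IsZero Z) :
    X.Realizes (0 : Z ⟶ C) (𝟙 C) (0 : X.Ext C Z) := by
  refine (X.realize_zero Z C).trans (_root_.Quotient.sound
    ⟨{ hom := biprod.snd
       inv := biprod.inr
       hom_inv_id := ?_ }, ?_, ?_⟩)
  · apply biprod.hom_ext
    · exact hZ.eq_of_tgt _ _
    · simp
  · exact hZ.eq_of_src _ _
  · simp

section Exact

variable {A B C : 𝓑} {x : A ⟶ B} {y : B ⟶ C} {δ : X.Ext C A}

lemma comp_eq_zero (h : X.Realizes x y δ) : x ≫ y = 0 := by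
  obtain ⟨c, -, hc⟩ := X.et3 (X.realizes_id_zero A (isZero_zero 𝓑)) h (𝟙 A) x (by simp)
  rw [← hc, zero_comp]

lemma push_eq_zero (h : X.Realizes x y δ) : X.push x δ = 0 := by
  obtain ⟨c, hc, -⟩ := X.et3 h (X.realizes_id_zero B (isZero_zero 𝓑)) x (𝟙 B) (by simp)
  rw [hc, pull_zero']

lemma pull_eq_zero (h : X.Realizes x y δ) : X.pull y δ = 0 := by
  obtain ⟨c, hc, -⟩ := X.et3op (X.realizes_zero_id B (isZero_zero 𝓑)) h (𝟙 B) y (by simp)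
  rw [← hc, push_zero']

lemma extend_of_push_eq_zero (h : X.Realizes x y δ) {Y : 𝓑} (g : A ⟶ Y) (hg : X.push g δ = 0) :
    ∃ k : B ⟶ Y, x ≫ k = g := by
  obtain ⟨b, hb, -⟩ := X.realize h (X.realize_zero Y C) g (𝟙 C) (by rw [hg, pull_zero'])
  exact ⟨b ≫ biprod.fst, by rw [reassoc_of% hb]; simp⟩

lemma lift_of_pull_eq_zero (h : X.Realizes x y δ) {Y : 𝓑} (g : Y ⟶ C) (hg : X.pull g δ = 0) :
    ∃ k : Y ⟶ B, k ≫ y = g := by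
  obtain ⟨b, -, hb⟩ := X.realize (X.realize_zero A Y) h (𝟙 A) g (by rw [hg, push_zero'])
  exact ⟨biprod.inr ≫ b, by rw [Category.assoc, ← hb]; simp⟩

lemma desc_of_comp_eq_zero (h : X.Realizes x y δ) {Y : 𝓑} (g : B ⟶ Y) (hg : x ≫ g = 0) :
    ∃ k : C ⟶ Y, y ≫ k = g := by
  obtain ⟨c, -, hc⟩ := X.et3 h (X.realizes_zero_id Y (isZero_zero 𝓑)) 0 g (by simp [hg])
  exact ⟨c, by simpa using hc⟩

lemma lift_of_comp_eq_zero (h : X.Realizes x y δ) {Y : 𝓑} (g : Y ⟶ B) (hg : g ≫ y = 0) :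
    ∃ k : Y ⟶ A, k ≫ x = g := by
  obtain ⟨a, -, ha⟩ := X.et3op (X.realizes_id_zero Y (isZero_zero 𝓑)) h g 0 (by simp [hg])
  exact ⟨a, by simpa using ha.symm⟩

lemma exists_push_of_pull_eq_zero (h : X.Realizes x y δ) {Y : 𝓑} (ε : X.Ext C Y)
    (hε : X.pull y ε = 0) : ∃ g : A ⟶ Y, X.push g δ = ε := by
  obtain ⟨M, m, e, hM⟩ := X.exists_realizes ε
  obtain ⟨b, hb⟩ := lift_of_pull_eq_zero hM y hε
  obtain ⟨a, ha, -⟩ := X.et3op h hM b (𝟙 C) (by simp [hb])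
  exact ⟨a, by rw [ha, pull_id]⟩

lemma exists_pull_of_push_eq_zero (h : X.Realizes x y δ) {Y : 𝓑} (ε : X.Ext Y A)
    (hε : X.push x ε = 0) : ∃ g : Y ⟶ C, X.pull g δ = ε := by
  obtain ⟨M, m, e, hM⟩ := X.exists_realizes ε
  obtain ⟨b, hb⟩ := extend_of_push_eq_zero hM x hε
  obtain ⟨c, hc, -⟩ := X.et3 hM h (𝟙 A) b (by simp [hb])
  exact ⟨c, by rw [← hc, push_id]⟩

lemma exists_pull_of_pull_eq_zero (h : X.Realizes x y δ) {Y : 𝓑} (ε : X.Ext B Y)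
    (hε : X.pull x ε = 0) : ∃ ε' : X.Ext C Y, X.pull y ε' = ε := by
  obtain ⟨M, m, e, hM⟩ := X.exists_realizes ε
  obtain ⟨E', h', d, e', δ'', -, -, -, h₁, -, h₂⟩ := X.et4op hM h
  rw [hε] at h₁
  obtain ⟨r, hr⟩ := extend_of_push_eq_zero h₁ (𝟙 Y) (push_zero' X _)
  refine ⟨X.push r δ'', ?_⟩
  rw [← push_pull, ← h₂, ← push_comp, hr, push_id]

lemma exists_push_of_push_eq_zero (h : X.Realizes x y δ) {Y : 𝓑} (ε : X.Ext Y B)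
    (hε : X.push y ε = 0) : ∃ ε' : X.Ext Y A, X.push x ε' = ε := by
  obtain ⟨M, m, e, hM⟩ := X.exists_realizes ε
  obtain ⟨E', h', d, e', δ'', -, -, -, h₁, -, h₂⟩ := X.et4 h hM
  rw [hε] at h₁
  obtain ⟨r, hr⟩ := lift_of_pull_eq_zero h₁ (𝟙 Y) (pull_zero' X _)
  refine ⟨X.pull r δ'', ?_⟩
  rw [push_pull, h₂, ← pull_comp, hr, pull_id]

end Exact

end ExtriangulatedCategory

/-! ### Subcategories and cotorsion pairs -/

/-- Full additive subcategories closed under isomorphisms and direct summands. -/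
structure IsAddSummandClosed {𝓑 : Type u} [Category.{v} 𝓑] [Preadditive 𝓑]
    [HasBinaryBiproducts 𝓑] (P : ObjectProperty 𝓑) : Prop where
  of_iso : ∀ {A B : 𝓑}, (A ≅ B) → P A → P B
  zero : ∀ {Z : 𝓑}, IsZero Z → P Z
  biprod : ∀ {A B : 𝓑}, P A → P B → P (A ⊞ B)
  summand : ∀ {A B : 𝓑}, P (A ⊞ B) → P A

section

variable {𝓑 : Type u} [Category.{v} 𝓑] [Preadditive 𝓑] [HasZeroObject 𝓑] [HasBinaryBiproducts 𝓑]

/-- `P ∗ Q`: objects `B` admitting a conflation `D₁ ⟶ B ⟶ D₂` with `D₁ ∈ P`, `D₂ ∈ Q`. -/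
def star (X : ExtriangulatedCategory.{w} 𝓑) (P Q : ObjectProperty 𝓑) : ObjectProperty 𝓑 :=
  fun B => ∃ (D₁ D₂ : 𝓑) (i : D₁ ⟶ B) (q : B ⟶ D₂), P D₁ ∧ Q D₂ ∧ X.Conflation i q

/-- `Cone(P, Q)`: objects `B` admitting a conflation `D₁ ⟶ D₂ ⟶ B` with `D₁ ∈ P`, `D₂ ∈ Q`. -/
def cone (X : ExtriangulatedCategory.{w} 𝓑) (P Q : ObjectProperty 𝓑) : ObjectProperty 𝓑 :=
  fun B => ∃ (D₁ D₂ : 𝓑) (i : D₁ ⟶ D₂) (q : D₂ ⟶ B), P D₁ ∧ Q D₂ ∧ X.Conflation i q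

/-- `CoCone(P, Q)`: objects `B` admitting a conflation `B ⟶ D₁ ⟶ D₂` with `D₁ ∈ P`, `D₂ ∈ Q`. -/
def cocone (X : ExtriangulatedCategory.{w} 𝓑) (P Q : ObjectProperty 𝓑) : ObjectProperty 𝓑 :=
  fun B => ∃ (D₁ D₂ : 𝓑) (i : B ⟶ D₁) (q : D₁ ⟶ D₂), P D₁ ∧ Q D₂ ∧ X.Conflation i q

/-- Closure under taking direct summands. -/
def addClosure (P : ObjectProperty 𝓑) : ObjectProperty 𝓑 := fun A => ∃ A' : 𝓑, P (A ⊞ A')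

end

/-- A (complete) cotorsion pair `(U, V)` in an extriangulated category. -/
structure CotorsionPair {𝓑 : Type u} [Category.{v} 𝓑] [Preadditive 𝓑] [HasZeroObject 𝓑]
    [HasBinaryBiproducts 𝓑] (X : ExtriangulatedCategory.{w} 𝓑) where
  U : ObjectProperty 𝓑
  V : ObjectProperty 𝓑
  hU : IsAddSummandClosed U
  hV : IsAddSummandClosed V
  ext_eq_zero : ∀ {A B : 𝓑}, U A → V B → ∀ δ : X.Ext A B, δ = 0
  exists_left : ∀ B : 𝓑, ∃ (V' U' : 𝓑) (x : V' ⟶ U') (y : U' ⟶ B),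
    V V' ∧ U U' ∧ X.Conflation x y
  exists_right : ∀ B : 𝓑, ∃ (V' U' : 𝓑) (x : B ⟶ V') (y : V' ⟶ U'),
    V V' ∧ U U' ∧ X.Conflation x y

namespace CotorsionPair

open ExtriangulatedCategory
open scoped ZeroObject

variable {𝓑 : Type u} [Category.{v} 𝓑] [Preadditive 𝓑] [HasZeroObject 𝓑] [HasBinaryBiproducts 𝓑]
  {X : ExtriangulatedCategory.{w} 𝓑} (P : CotorsionPair X)

/-- The core `W = U ∩ V`. -/
def W : ObjectProperty 𝓑 := fun B => P.U B ∧ P.V B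

/-- `𝓑⁺ = Cone(V, W)` -/
def Bplus : ObjectProperty 𝓑 := cone X P.V P.W

/-- `𝓑⁻ = CoCone(W, U)` -/
def Bminus : ObjectProperty 𝓑 := cocone X P.W P.U

/-- The kernel `K = add(U ∗ V)`. -/
def kernel : ObjectProperty 𝓑 := addClosure (star X P.U P.V)

/-! #### The quotient category `𝓑 / W` -/

/-- `f` factors through an object of `W`. -/
def Factors {A B : 𝓑} (f : A ⟶ B) : Prop :=
  ∃ (D : 𝓑) (i : A ⟶ D) (p : D ⟶ B), P.W D ∧ i ≫ p = f

/-- Congruence modulo the morphisms which factor through `W`. -/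
def rel : HomRel 𝓑 := fun _ _ f g => P.Factors (f - g)

variable {P}

lemma Factors.zero {A B : 𝓑} : P.Factors (0 : A ⟶ B) :=
  ⟨0, 0, 0, ⟨P.hU.zero (isZero_zero 𝓑), P.hV.zero (isZero_zero 𝓑)⟩, by simp⟩

lemma Factors.add {A B : 𝓑} {f g : A ⟶ B} (hf : P.Factors f) (hg : P.Factors g) :
    P.Factors (f + g) := by
  obtain ⟨D, i, p, hD, rfl⟩ := hf
  obtain ⟨D', i', p', hD', rfl⟩ := hg
  exact ⟨D ⊞ D', biprod.lift i i', biprod.desc p p',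
    ⟨P.hU.biprod hD.1 hD'.1, P.hV.biprod hD.2 hD'.2⟩, by simp⟩

lemma Factors.neg {A B : 𝓑} {f : A ⟶ B} (hf : P.Factors f) : P.Factors (-f) := by
  obtain ⟨D, i, p, hD, rfl⟩ := hf
  exact ⟨D, -i, p, hD, by simp⟩

lemma Factors.precomp {A B C : 𝓑} (f : A ⟶ B) {g : B ⟶ C} (hg : P.Factors g) :
    P.Factors (f ≫ g) := by
  obtain ⟨D, i, p, hD, rfl⟩ := hg
  exact ⟨D, f ≫ i, p, hD, by simp⟩

lemma Factors.postcomp {A B C : 𝓑} {f : A ⟶ B} (hf : P.Factors f) (g : B ⟶ C) :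
    P.Factors (f ≫ g) := by
  obtain ⟨D, i, p, hD, rfl⟩ := hf
  exact ⟨D, i, p ≫ g, hD, by simp⟩

variable (P)

instance rel_congruence : Congruence P.rel where
  equivalence :=
    { refl := fun f => by simpa [rel] using Factors.zero
      symm := fun {f g} h => by simpa [rel] using Factors.neg h
      trans := fun {f g k} h h' => by simpa [rel] using Factors.add h h' }
  comp_left := fun f _ _ h => by
    simpa [rel, Preadditive.comp_sub] using Factors.precomp f h
  comp_right := fun g h => by
    simpa [rel, Preadditive.sub_comp] using Factors.postcomp h g

/-- The quotient category `𝓑 / W`. -/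
abbrev Quot := CategoryTheory.Quotient P.rel

/-- The canonical quotient functor `π : 𝓑 ⥤ 𝓑 / W`. -/
abbrev π : 𝓑 ⥤ P.Quot := CategoryTheory.Quotient.functor P.rel

/-- `𝓑⁺ / W` as a full subcategory of `𝓑 / W`. -/
def QPlus : ObjectProperty P.Quot := fun B => P.Bplus B.as

/-- `𝓑⁻ / W` as a full subcategory of `𝓑 / W`. -/
def QMinus : ObjectProperty P.Quot := fun B => P.Bminus B.as

/-- The objects of `H = 𝓑⁺ ∩ 𝓑⁻`. -/
def QHeart : ObjectProperty P.Quot := fun B => P.Bplus B.as ∧ P.Bminus B.as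

/-- The heart `(𝓑⁺ ∩ 𝓑⁻) / W`, a full subcategory of `𝓑 / W`. -/
abbrev Heart := P.QHeart.FullSubcategory

lemma π_map_eq_iff {A B : 𝓑} (f g : A ⟶ B) : P.π.map f = P.π.map g ↔ P.Factors (f - g) :=
  CategoryTheory.Quotient.functor_map_eq_iff P.rel f g

/-! #### Reflection and coreflection sequences -/

/-- `B ⟶ Z ⟶ S` is a reflection sequence for `B`. -/
structure IsReflectionSeq {B Z S : 𝓑} (z : B ⟶ Z) (q : Z ⟶ S) : Prop where
  conflation : X.Conflation z q
  hZ : P.Bplus Z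
  hS : P.U S
  surj : ∀ (V' : 𝓑), P.V V' → Function.Surjective (fun δ : X.Ext Z V' => X.pull z δ)

/-- `V' ⟶ Z ⟶ B` is a coreflection sequence for `B`. -/
structure IsCoreflectionSeq {V' Z B : 𝓑} (j : V' ⟶ Z) (z : Z ⟶ B) : Prop where
  conflation : X.Conflation j z
  hZ : P.Bminus Z
  hV : P.V V'
  surj : ∀ (S : 𝓑), P.U S → Function.Surjective (fun δ : X.Ext S Z => X.push z δ)

variable {P}

lemma mem_U_of_ext {T : 𝓑} (h : ∀ V', P.V V' → ∀ δ : X.Ext T V', δ = 0) : P.U T := by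
  obtain ⟨V', U', x, y, hV', hU', δ, hδ⟩ := P.exists_left T
  obtain rfl := h _ hV' δ
  obtain ⟨e, -, -⟩ := realizes_iso hδ (X.realize_zero V' T)
  exact P.hU.summand (P.hU.of_iso (e ≪≫ biprod.braiding _ _) hU')

lemma mem_V_of_ext {T : 𝓑} (h : ∀ U', P.U U' → ∀ δ : X.Ext U' T, δ = 0) : P.V T := by
  obtain ⟨V', U', x, y, hV', hU', δ, hδ⟩ := P.exists_right T
  obtain rfl := h _ hU' δ
  obtain ⟨e, -, -⟩ := realizes_iso hδ (X.realize_zero T U')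
  exact P.hV.summand (P.hV.of_iso e hV')

lemma U_of_extension {A B C : 𝓑} {x : A ⟶ B} {y : B ⟶ C} {δ : X.Ext C A} (h : X.Realizes x y δ)
    (hA : P.U A) (hC : P.U C) : P.U B :=
  mem_U_of_ext fun V' hV' ε => by
    obtain ⟨ε', rfl⟩ := exists_pull_of_pull_eq_zero h ε (P.ext_eq_zero hA hV' _)
    rw [P.ext_eq_zero hC hV' ε', pull_zero']

lemma V_of_extension {A B C : 𝓑} {x : A ⟶ B} {y : B ⟶ C} {δ : X.Ext C A} (h : X.Realizes x y δ)
    (hA : P.V A) (hC : P.V C) : P.V B :=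
  mem_V_of_ext fun U' hU' ε => by
    obtain ⟨ε', rfl⟩ := exists_push_of_push_eq_zero h ε (P.ext_eq_zero hU' hC _)
    rw [P.ext_eq_zero hU' hA ε', push_zero']

variable (P)

lemma exists_reflectionSeq (B : 𝓑) :
    ∃ (Z S : 𝓑) (z : B ⟶ Z) (q : Z ⟶ S), P.IsReflectionSeq z q := by
  obtain ⟨V', U', x, y, hV', hU', δ, hδ⟩ := P.exists_left B
  obtain ⟨T, S, u, t, hT, hS, δ', hδ'⟩ := P.exists_right U'
  obtain ⟨Z, h', d, e, δ'', -, -, h₁, h₂, h₃, -⟩ := X.et4 hδ hδ'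
  refine ⟨Z, S, d, e, ⟨_, h₂⟩, ⟨V', T, _, _, hV', ⟨U_of_extension hδ' hU' hS, hT⟩, _, h₁⟩, hS, ?_⟩
  intro V₀ hV₀ ε
  obtain ⟨g, hg⟩ := exists_push_of_pull_eq_zero hδ ε (P.ext_eq_zero hU' hV₀ _)
  exact ⟨X.push g δ'', by simp only; rw [← push_pull, h₃, hg]⟩

lemma exists_coreflectionSeq (B : 𝓑) :
    ∃ (V' Z : 𝓑) (j : V' ⟶ Z) (z : Z ⟶ B), P.IsCoreflectionSeq j z := by
  obtain ⟨T, S, x, y, hT, hS, δ, hδ⟩ := P.exists_right B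
  obtain ⟨V', U', v, t, hV', hU', δ', hδ'⟩ := P.exists_left T
  obtain ⟨Z, h', d, e, δ'', -, -, h₁, h₂, h₃, -⟩ := X.et4op hδ' hδ
  refine ⟨V', Z, d, e, ⟨_, h₂⟩, ⟨U', S, _, _, ⟨hU', V_of_extension hδ' hV' hT⟩, hS, _, h₁⟩, hV', ?_⟩
  intro U₀ hU₀ ε
  obtain ⟨g, hg⟩ := exists_pull_of_push_eq_zero hδ ε (P.ext_eq_zero hU₀ hT _)
  exact ⟨X.pull g δ'', by simp only; rw [push_pull, h₃, hg]⟩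

variable {P}

lemma IsReflectionSeq.exists_lift {B Z S : 𝓑} {z : B ⟶ Z} {q : Z ⟶ S}
    (h : P.IsReflectionSeq z q) {Y : 𝓑} (hY : P.Bplus Y) (f : B ⟶ Y) :
    ∃ g : Z ⟶ Y, P.Factors (z ≫ g - f) := by
  obtain ⟨ν, hν⟩ := h.conflation
  obtain ⟨V', W', i, p, hV', hW', l, hl⟩ := hY
  obtain ⟨β, hβ⟩ := h.surj V' hV' (X.pull f l)
  have hβ' : X.pull z β = X.pull f l := hβ
  have h₁ : X.push i β = 0 := by
    obtain ⟨ε, hε⟩ := exists_pull_of_pull_eq_zero hν (X.push i β)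
      (by rw [← push_pull, hβ', push_pull, push_eq_zero hl, pull_zero'])
    rw [← hε, P.ext_eq_zero h.hS hW'.2 ε, pull_zero']
  obtain ⟨g, rfl⟩ := exists_pull_of_push_eq_zero hl β h₁
  obtain ⟨k, hk⟩ := lift_of_pull_eq_zero hl (z ≫ g - f)
    (by rw [pull_sub_hom, pull_comp, hβ', sub_self])
  exact ⟨g, W', k, p, hW', hk⟩

lemma IsReflectionSeq.factors {B Z S : 𝓑} {z : B ⟶ Z} {q : Z ⟶ S}
    (h : P.IsReflectionSeq z q) {Y : 𝓑} (hY : P.Bplus Y) (g : Z ⟶ Y)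
    (hg : P.Factors (z ≫ g)) : P.Factors g := by
  obtain ⟨ν, hν⟩ := h.conflation
  obtain ⟨V', W', i, p, hV', hW', l, hl⟩ := hY
  obtain ⟨D, a, b, hD, hab⟩ := hg
  obtain ⟨b', rfl⟩ := lift_of_pull_eq_zero hl b (P.ext_eq_zero hD.1 hV' _)
  obtain ⟨k, hk⟩ := extend_of_push_eq_zero hν (a ≫ b') (P.ext_eq_zero h.hS hW'.2 _)
  obtain ⟨c, hc⟩ := desc_of_comp_eq_zero hν (g - k ≫ p)
    (by rw [Preadditive.comp_sub, reassoc_of% hk, ← hab, sub_self])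
  obtain ⟨c', rfl⟩ := lift_of_pull_eq_zero hl c (P.ext_eq_zero h.hS hV' _)
  exact ⟨W', q ≫ c' + k, p, hW', by simp [hc]⟩

lemma IsCoreflectionSeq.exists_lift {V₀ Z B : 𝓑} {j : V₀ ⟶ Z} {z : Z ⟶ B}
    (h : P.IsCoreflectionSeq j z) {Y : 𝓑} (hY : P.Bminus Y) (f : Y ⟶ B) :
    ∃ g : Y ⟶ Z, P.Factors (g ≫ z - f) := by
  obtain ⟨ν, hν⟩ := h.conflation
  obtain ⟨W', U', i, p, hW', hU', l, hl⟩ := hY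
  obtain ⟨β, hβ⟩ := h.surj U' hU' (X.push f l)
  have hβ' : X.push z β = X.push f l := hβ
  have h₁ : X.pull p β = 0 := by
    obtain ⟨ε, hε⟩ := exists_push_of_push_eq_zero hν (X.pull p β)
      (by rw [push_pull, hβ', ← push_pull, pull_eq_zero hl, push_zero'])
    rw [← hε, P.ext_eq_zero hW'.1 h.hV ε, push_zero']
  obtain ⟨g, rfl⟩ := exists_push_of_pull_eq_zero hl β h₁
  obtain ⟨k, hk⟩ := extend_of_push_eq_zero hl (g ≫ z - f)
    (by rw [push_sub_hom, push_comp, hβ', sub_self])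
  exact ⟨g, W', i, k, hW', hk⟩

lemma IsCoreflectionSeq.factors {V₀ Z B : 𝓑} {j : V₀ ⟶ Z} {z : Z ⟶ B}
    (h : P.IsCoreflectionSeq j z) {Y : 𝓑} (hY : P.Bminus Y) (g : Y ⟶ Z)
    (hg : P.Factors (g ≫ z)) : P.Factors g := by
  obtain ⟨ν, hν⟩ := h.conflation
  obtain ⟨W', U', i, p, hW', hU', l, hl⟩ := hY
  obtain ⟨D, a, b, hD, hab⟩ := hg
  obtain ⟨a', rfl⟩ := extend_of_push_eq_zero hl a (P.ext_eq_zero hU' hD.2 _)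
  obtain ⟨k, hk⟩ := lift_of_pull_eq_zero hν (a' ≫ b) (P.ext_eq_zero hW'.1 h.hV _)
  obtain ⟨c, hc⟩ := lift_of_comp_eq_zero hν (g - i ≫ k)
    (by rw [Preadditive.sub_comp, Category.assoc, hk, ← hab, Category.assoc, sub_self])
  obtain ⟨c', rfl⟩ := extend_of_push_eq_zero hl c (P.ext_eq_zero hU' h.hV _)
  exact ⟨W', i, c' ≫ j + k, hW', by
    rw [Preadditive.comp_add, ← Category.assoc, hc, sub_add_cancel]⟩

/-- In a coreflection sequence `V' ⟶ Z ⟶ B` with `B ∈ 𝓑⁺`, also `Z ∈ 𝓑⁺`. -/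
lemma IsCoreflectionSeq.bplus {V₀ Z B : 𝓑} {j : V₀ ⟶ Z} {z : Z ⟶ B}
    (h : P.IsCoreflectionSeq j z) (hB : P.Bplus B) : P.Bplus Z := by
  obtain ⟨ν, hν⟩ := h.conflation
  obtain ⟨V', W', i, p, hV', hW', l, hl⟩ := hB
  obtain ⟨V₁, U₁, x, y, hV₁, hU₁, δ, hδ⟩ := P.exists_left Z
  obtain ⟨k, hk⟩ := lift_of_pull_eq_zero hl (y ≫ z) (P.ext_eq_zero hU₁ hV' _)
  refine ⟨V₁, U₁, x, y, hV₁, ⟨hU₁, mem_V_of_ext fun U' hU' ε => ?_⟩, δ, hδ⟩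
  have h₁ : X.push z (X.push y ε) = 0 := by
    rw [← push_comp, ← hk, push_comp, P.ext_eq_zero hU' hW'.2 (X.push k ε), push_zero']
  obtain ⟨ε₁, hε₁⟩ := exists_push_of_push_eq_zero hν _ h₁
  have h₂ : X.push y ε = 0 := by rw [← hε₁, P.ext_eq_zero hU' h.hV ε₁, push_zero']
  obtain ⟨ε₂, rfl⟩ := exists_push_of_push_eq_zero hδ _ h₂
  rw [P.ext_eq_zero hU' hV₁ ε₂, push_zero']

variable (P)

/-! #### The functors `σ⁺`, `σ⁻` and `H` -/

/-- A chosen reflection sequence `B ⟶ B⁺ ⟶ S`: the object `B⁺`. -/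
def plus (B : 𝓑) : 𝓑 := (P.exists_reflectionSeq B).choose

/-- The object `S` in the chosen reflection sequence. -/
def plusS (B : 𝓑) : 𝓑 := (P.exists_reflectionSeq B).choose_spec.choose

/-- The morphism `B ⟶ B⁺` in the chosen reflection sequence. -/
def toPlus (B : 𝓑) : B ⟶ P.plus B := (P.exists_reflectionSeq B).choose_spec.choose_spec.choose

/-- The morphism `B⁺ ⟶ S` in the chosen reflection sequence. -/
def plusToS (B : 𝓑) : P.plus B ⟶ P.plusS B :=
  (P.exists_reflectionSeq B).choose_spec.choose_spec.choose_spec.choose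

lemma isReflectionSeq_plus (B : 𝓑) : P.IsReflectionSeq (P.toPlus B) (P.plusToS B) :=
  (P.exists_reflectionSeq B).choose_spec.choose_spec.choose_spec.choose_spec

/-- The object `V'` in a chosen coreflection sequence `V' ⟶ B⁻ ⟶ B`. -/
def minusV (B : 𝓑) : 𝓑 := (P.exists_coreflectionSeq B).choose

/-- The object `B⁻` in the chosen coreflection sequence. -/
def minus (B : 𝓑) : 𝓑 := (P.exists_coreflectionSeq B).choose_spec.choose

/-- The morphism `V' ⟶ B⁻` in the chosen coreflection sequence. -/
def vToMinus (B : 𝓑) : P.minusV B ⟶ P.minus B :=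
  (P.exists_coreflectionSeq B).choose_spec.choose_spec.choose

/-- The morphism `B⁻ ⟶ B` in the chosen coreflection sequence. -/
def fromMinus (B : 𝓑) : P.minus B ⟶ B :=
  (P.exists_coreflectionSeq B).choose_spec.choose_spec.choose_spec.choose

lemma isCoreflectionSeq_minus (B : 𝓑) : P.IsCoreflectionSeq (P.vToMinus B) (P.fromMinus B) :=
  (P.exists_coreflectionSeq B).choose_spec.choose_spec.choose_spec.choose_spec

/-- `B⁺` as an object of `𝓑⁺ / W`. -/
def plusObj (B : P.Quot) : P.QPlus.FullSubcategory :=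
  ⟨P.π.obj (P.plus B.as), (P.isReflectionSeq_plus B.as).hZ⟩

/-- `B⁻` as an object of `𝓑⁻ / W`. -/
def minusObj (B : P.Quot) : P.QMinus.FullSubcategory :=
  ⟨P.π.obj (P.minus B.as), (P.isCoreflectionSeq_minus B.as).hZ⟩

/-- The class of `B ⟶ B⁺` in `𝓑 / W`. -/
def unitMap (B : P.Quot) : B ⟶ (P.plusObj B).obj := P.π.map (P.toPlus B.as)

/-- The class of `B⁻ ⟶ B` in `𝓑 / W`. -/
def counitMap (B : P.Quot) : (P.minusObj B).obj ⟶ B := P.π.map (P.fromMinus B.as)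

lemma bijective_unitMap (B : P.Quot) (Y : P.QPlus.FullSubcategory) :
    Function.Bijective
      (fun g : P.plusObj B ⟶ Y => (P.unitMap B ≫ g.hom : B ⟶ P.QPlus.ι.obj Y)) := by
  obtain ⟨⟨Y⟩, hY⟩ := Y
  obtain ⟨B⟩ := B
  constructor
  · intro g g' hgg'
    obtain ⟨k, hk⟩ := P.π.map_surjective g.hom
    obtain ⟨k', hk'⟩ := P.π.map_surjective g'.hom
    apply ObjectProperty.hom_ext
    refine hk.symm.trans (Eq.trans ((P.π_map_eq_iff k k').2 ?_) hk')
    refine (P.isReflectionSeq_plus B).factors hY _ ?_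
    rw [Preadditive.comp_sub, ← π_map_eq_iff, Functor.map_comp, Functor.map_comp, hk, hk']
    exact hgg'
  · intro f
    obtain ⟨f, rfl⟩ := P.π.map_surjective f
    obtain ⟨g, hg⟩ := (P.isReflectionSeq_plus B).exists_lift hY f
    refine ⟨ObjectProperty.homMk (P.π.map g), ?_⟩
    rw [← π_map_eq_iff, Functor.map_comp] at hg
    exact hg

lemma bijective_counitMap (Y : P.QMinus.FullSubcategory) (B : P.Quot) :
    Function.Bijective
      (fun g : Y ⟶ P.minusObj B => (g.hom ≫ P.counitMap B : P.QMinus.ι.obj Y ⟶ B)) := by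
  obtain ⟨⟨Y⟩, hY⟩ := Y
  obtain ⟨B⟩ := B
  constructor
  · intro g g' hgg'
    obtain ⟨k, hk⟩ := P.π.map_surjective g.hom
    obtain ⟨k', hk'⟩ := P.π.map_surjective g'.hom
    apply ObjectProperty.hom_ext
    refine hk.symm.trans (Eq.trans ((P.π_map_eq_iff k k').2 ?_) hk')
    refine (P.isCoreflectionSeq_minus B).factors hY _ ?_
    rw [Preadditive.sub_comp, ← π_map_eq_iff, Functor.map_comp, Functor.map_comp, hk, hk']
    exact hgg'
  · intro f
    obtain ⟨f, rfl⟩ := P.π.map_surjective f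
    obtain ⟨g, hg⟩ := (P.isCoreflectionSeq_minus B).exists_lift hY f
    refine ⟨ObjectProperty.homMk (P.π.map g), ?_⟩
    rw [← π_map_eq_iff, Functor.map_comp] at hg
    exact hg

/-- `Hom(B⁺, Y) ≃ Hom(B, Y)` for `Y ∈ 𝓑⁺`, in `𝓑 / W`. -/
def plusEquiv (B : P.Quot) (Y : P.QPlus.FullSubcategory) :
    (P.plusObj B ⟶ Y) ≃ (B ⟶ P.QPlus.ι.obj Y) :=
  Equiv.ofBijective _ (P.bijective_unitMap B Y)

/-- `Hom(Y, B) ≃ Hom(Y, B⁻)` for `Y ∈ 𝓑⁻`, in `𝓑 / W`. -/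
def minusEquiv (Y : P.QMinus.FullSubcategory) (B : P.Quot) :
    (P.QMinus.ι.obj Y ⟶ B) ≃ (Y ⟶ P.minusObj B) :=
  (Equiv.ofBijective _ (P.bijective_counitMap Y B)).symm

lemma plusEquiv_comp (B : P.Quot) (Y Y' : P.QPlus.FullSubcategory) (g : Y ⟶ Y')
    (h : P.plusObj B ⟶ Y) :
    P.plusEquiv B Y' (h ≫ g) = P.plusEquiv B Y h ≫ P.QPlus.ι.map g := by
  simp [plusEquiv]

lemma minusEquiv_comp (Y' Y : P.QMinus.FullSubcategory) (B : P.Quot) (f : Y' ⟶ Y)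
    (g : P.QMinus.ι.obj Y ⟶ B) :
    P.minusEquiv Y' B (P.QMinus.ι.map f ≫ g) = f ≫ P.minusEquiv Y B g := by
  obtain ⟨g, rfl⟩ := (P.minusEquiv Y B).symm.surjective g
  rw [Equiv.apply_symm_apply, ← Equiv.eq_symm_apply]
  simp [minusEquiv]

/-- `σ⁺ : 𝓑 / W ⥤ 𝓑⁺ / W`, sending `B` to `B⁺` and `f : B ⟶ C` to the unique morphism compatible
with `B ⟶ B⁺` and `C ⟶ C⁺`. -/
def sigmaPlus : P.Quot ⥤ P.QPlus.FullSubcategory :=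
  Adjunction.leftAdjointOfEquiv P.plusEquiv P.plusEquiv_comp

/-- `σ⁻ : 𝓑 / W ⥤ 𝓑⁻ / W`, sending `B` to `B⁻` and `f : B ⟶ C` to the unique morphism compatible
with `B⁻ ⟶ B` and `C⁻ ⟶ C`. -/
def sigmaMinus : P.Quot ⥤ P.QMinus.FullSubcategory :=
  Adjunction.rightAdjointOfEquiv P.minusEquiv P.minusEquiv_comp

/-- `σ⁺` is left adjoint to the inclusion of `𝓑⁺ / W`. -/
def sigmaPlusAdj : P.sigmaPlus ⊣ P.QPlus.ι :=
  Adjunction.adjunctionOfEquivLeft P.plusEquiv P.plusEquiv_comp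

/-- `σ⁻` is right adjoint to the inclusion of `𝓑⁻ / W`. -/
def sigmaMinusAdj : P.QMinus.ι ⊣ P.sigmaMinus :=
  Adjunction.adjunctionOfEquivRight P.minusEquiv P.minusEquiv_comp

lemma sigma_mem_heart (B : P.Quot) :
    P.QHeart ((P.sigmaPlus ⋙ P.QPlus.ι ⋙ P.sigmaMinus ⋙ P.QMinus.ι).obj B) :=
  ⟨(P.isCoreflectionSeq_minus _).bplus (P.isReflectionSeq_plus B.as).hZ,
    (P.isCoreflectionSeq_minus _).hZ⟩

/-- The associated functor `H = σ⁻ ∘ σ⁺ ∘ π` from `𝓑` to the heart. -/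
def H : 𝓑 ⥤ P.Heart :=
  P.π ⋙ P.QHeart.lift (P.sigmaPlus ⋙ P.QPlus.ι ⋙ P.sigmaMinus ⋙ P.QMinus.ι) P.sigma_mem_heart

/-- `H` vanishes on the objects of `D`. -/
def HVanishesOn (D : ObjectProperty 𝓑) : Prop := ∀ B : 𝓑, D B → IsZero (P.H.obj B)

variable {P}

/-- Two cotorsion pairs are heart-equivalent if there is an equivalence `e` of the hearts such that
`e ∘ H` is naturally isomorphic to `H'`. -/
def HeartEquivalent (P P' : CotorsionPair X) : Prop :=
  ∃ e : P.Heart ≌ P'.Heart, Nonempty (P.H ⋙ e.functor ≅ P'.H)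

end CotorsionPair

end ExtriCat

end

/-! The link between the conditions is that the kernel consists exactly of the objects killed by `H`
(`kernel_iff_isZero_H`). A heart-equivalence therefore forces equal kernels. Equal kernels give the
vanishing conditions, because `U` and `V` lie in the kernel.

For the way back, suppose `H'` kills `U` and `V`. Then `H'` factors through `𝓑 / W` and inverts both
arrows of `B ⟶ B⁺ ⟵ (B⁺)⁻`, so `H'` is `H` followed by the functor that `H'` induces on the heart of
`P` (`nonempty_H_comp_HBar`). By symmetry `H` induces a functor in the other direction, and the two
are quasi-inverse because `σ⁻ ∘ σ⁺` is the identity on a heart.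

That `H'` inverts these arrows rests on two facts. It sends inflations with cone in its kernel to
epimorphisms and deflations with fiber in its kernel to monomorphisms (`epi_H_of_cone_kernel`,
`mono_H_of_fiber_kernel`), and its heart is balanced (`isIso_heartMap`). Neither abelianness of the
heart nor long exact sequences are needed. -/

namespace ExtriCat

/-! ### Conflations: change of end terms, direct sums, pullbacks and pushouts. -/

namespace ExtriangulatedCategory

variable {𝓑 : Type u} [Category.{v} 𝓑] [Preadditive 𝓑] [HasZeroObject 𝓑] [HasBinaryBiproducts 𝓑]
  {X : ExtriangulatedCategory.{w} 𝓑}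

/-- An endomorphism of an `𝔼`-triangle which is the identity at both ends is invertible. -/
lemma isIso_of_ends_id {A B C : 𝓑} {x : A ⟶ B} {y : B ⟶ C} {δ : X.Ext C A}
    (h : X.Realizes x y δ) (e : B ⟶ B) (h₁ : x ≫ e = x) (h₂ : e ≫ y = y) : IsIso e := by
  obtain ⟨k, hk⟩ := desc_of_comp_eq_zero h (e - 𝟙 B) (by simp [h₁])
  have h₃ : e ≫ (e - 𝟙 B) = e - 𝟙 B := by rw [← hk, reassoc_of% h₂]
  have h₄ : e ≫ e = e + e - 𝟙 B := by
    rw [Preadditive.comp_sub, Category.comp_id] at h₃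
    rw [← sub_add_cancel (e ≫ e) e, h₃]
    abel
  -- `e - 𝟙` factors through `y`, which `e` fixes; so `(e - 𝟙)² = 0` and the inverse of `e` is `𝟙 -
  -- (e - 𝟙)`.
  refine ⟨𝟙 B + 𝟙 B - e, ?_, ?_⟩
  · simp only [Preadditive.comp_sub, Preadditive.comp_add, Category.comp_id, h₄]
    abel
  · simp only [Preadditive.sub_comp, Preadditive.add_comp, Category.id_comp, h₄]
    abel

/-- Equivalence of sequences fixes the ends, so isomorphic ends need an argument: compare with any
realization of the transported extension, in both directions. Both composites are the identity at
the ends, hence invertible. -/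
lemma realizes_of_iso_ends {A A' B C C' : 𝓑} {x : A ⟶ B} {y : B ⟶ C} {δ : X.Ext C A}
    (h : X.Realizes x y δ) (a : A ≅ A') (c : C ≅ C') :
    X.Realizes (a.inv ≫ x) (y ≫ c.hom) (X.pull c.inv (X.push a.hom δ)) := by
  obtain ⟨B', x', y', h'⟩ := X.exists_realizes (X.pull c.inv (X.push a.hom δ))
  obtain ⟨b, hb₁, hb₂⟩ := X.realize h h' a.hom c.hom (by rw [← pull_comp]; simp [pull_id])
  obtain ⟨b', hb₁', hb₂'⟩ := X.realize h' h a.inv c.inv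
    (by rw [push_pull, ← push_comp]; simp [push_id])
  have i₁ : IsIso (b ≫ b') := isIso_of_ends_id h _ (by simp [reassoc_of% hb₁, hb₁'])
    (by simp [← hb₂', ← reassoc_of% hb₂])
  have i₂ : IsIso (b' ≫ b) := isIso_of_ends_id h' _ (by simp [reassoc_of% hb₁', hb₁])
    (by simp [← hb₂, ← reassoc_of% hb₂'])
  have : Mono b := mono_of_mono b b'
  have : IsSplitEpi b := IsSplitEpi.mk' ⟨inv (b' ≫ b) ≫ b', by simp⟩
  have : IsIso b := isIso_of_mono_of_isSplitEpi b
  convert realizes_of_iso h' (asIso b).symm using 1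
  · simp [← cancel_mono b, hb₁]
  · simp [hb₂]

/-- Direct sum of an `𝔼`-triangle with the triangle `0 ⟶ S ⟶ S`. -/
lemma realizes_add_right {A B C : 𝓑} {x : A ⟶ B} {y : B ⟶ C} {δ : X.Ext C A}
    (h : X.Realizes x y δ) (S : 𝓑) :
    X.Realizes (x ≫ (biprod.inl : B ⟶ B ⊞ S)) (biprod.map y (𝟙 S)) (X.pull biprod.fst δ) := by
  have h₁ := realizes_of_iso_ends (X.realize_dsum h (realizes_zero_id S (isZero_zero 𝓑)))
    { hom := biprod.fst
      inv := biprod.inl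
      hom_inv_id := by
        apply biprod.hom_ext
        · simp
        · exact (isZero_zero 𝓑).eq_of_tgt _ _ } (Iso.refl _)
  convert h₁ using 1
  · simp
  · simp
  · simp only [Iso.refl_inv, pull_id]
    rw [ExtStructure.dsum, push_zero', pull_zero', add_zero, push_pull, ← push_comp,
      biprod.inl_fst, push_id]

/-- Direct sum of an `𝔼`-triangle with the triangle `S ⟶ S ⟶ 0`. -/
lemma realizes_add_left {A B C : 𝓑} {x : A ⟶ B} {y : B ⟶ C} {δ : X.Ext C A}
    (h : X.Realizes x y δ) (S : 𝓑) :
    X.Realizes (biprod.map x (𝟙 S)) ((biprod.fst : B ⊞ S ⟶ B) ≫ y) (X.push biprod.inl δ) := by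
  have h₁ := realizes_of_iso_ends (X.realize_dsum h (realizes_id_zero S (isZero_zero 𝓑)))
    (Iso.refl _)
    { hom := biprod.fst
      inv := biprod.inl
      hom_inv_id := by
        apply biprod.hom_ext
        · simp
        · exact (isZero_zero 𝓑).eq_of_tgt _ _ }
  convert h₁ using 1
  · simp
  · simp
  · simp only [Iso.refl_hom, push_id]
    rw [ExtStructure.dsum, push_zero', pull_zero', add_zero, ← pull_comp, biprod.inl_fst, pull_id]

/-- The conflation `U ⟶ B ⊞ R ⟶ Z` attached to the pullback of an `𝔼`-triangle
`V ⟶ R ⟶ Z` along `z : B ⟶ Z`. -/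
lemma exists_conflation_of_pull {V R Z B U : 𝓑} {x' : V ⟶ R} {y' : R ⟶ Z} {θ : X.Ext Z V}
    (h : X.Realizes x' y' θ) (z : B ⟶ Z) {x : V ⟶ U} {y : U ⟶ B}
    (hU : X.Realizes x y (X.pull z θ)) :
    ∃ k : U ⟶ R, x ≫ k = x' ∧ X.Conflation (biprod.lift y k) (biprod.desc (-z) y') := by
  -- The split triangle `B ⟶ Z ⊞ B ⟶ Z` with maps `(z, 1)` and `(1, -z)`: the graph of `z`.
  -- Composing the deflation `R ⊞ B ⟶ Z ⊞ B` with `(1, -z)` gives a fiber which realizes the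
  -- pullback of `θ` along `z`, so it is `U`.
  have h₂ := realizes_of_iso (X.realize_zero B Z)
    { hom := (biprod.lift (biprod.desc z (𝟙 Z)) biprod.fst : B ⊞ Z ⟶ Z ⊞ B)
      inv := biprod.lift biprod.snd (biprod.desc (𝟙 Z) (-z))
      hom_inv_id := by apply biprod.hom_ext' <;> apply biprod.hom_ext <;> simp
      inv_hom_id := by apply biprod.hom_ext' <;> apply biprod.hom_ext <;> simp }
  obtain ⟨E', h', d, e, δ'', hd, he, h₃, h₄, -, -⟩ := X.et4op (realizes_add_right h B) h₂
  rw [← pull_comp] at h₄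
  have hz : (biprod.inl ≫ biprod.lift (biprod.desc z (𝟙 Z)) biprod.fst : B ⟶ Z ⊞ B) ≫ biprod.fst
      = z := by simp
  dsimp only at h₄
  rw [hz] at h₄
  obtain ⟨i, hi₁, hi₂⟩ := realizes_iso hU h₄
  have h₅ := realizes_of_iso (realizes_of_iso_ends h₃ i.symm (Iso.refl _)) (biprod.braiding R B)
  refine ⟨i.hom ≫ h' ≫ biprod.fst, ?_, ?_⟩
  · rw [reassoc_of% hi₁, reassoc_of% hd]
    simp
  · have h₆ : X.Conflation _ _ := ⟨_, h₅⟩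
    convert h₆ using 1
    · have : h' ≫ biprod.snd = e := by
        simpa using he =≫ biprod.snd
      apply biprod.hom_ext <;> simp [this, hi₂]
    · have : biprod.map y' (𝟙 B) ≫ biprod.desc (𝟙 Z) (-z) = biprod.desc y' (-z) := by
        apply biprod.hom_ext' <;> simp
      apply biprod.hom_ext' <;> simp [this]

/-- The conflation `A ⟶ B ⊞ D ⟶ E` attached to the pushout of an `𝔼`-triangle
`A ⟶ B ⟶ C` along `f : A ⟶ D`. -/
lemma exists_conflation_of_push {A B C D E : 𝓑} {x : A ⟶ B} {y : B ⟶ C} {θ : X.Ext C A}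
    (h : X.Realizes x y θ) (f : A ⟶ D) {x' : D ⟶ E} {y' : E ⟶ C}
    (hE : X.Realizes x' y' (X.push f θ)) :
    ∃ k : B ⟶ E, k ≫ y' = y ∧ X.Conflation (biprod.lift x (-f)) (biprod.desc k x') := by
  -- Dually, the split triangle `A ⟶ A ⊞ D ⟶ D` with maps `(1, -f)` and `(f, 1)`, composed with the
  -- inflation `A ⊞ D ⟶ B ⊞ D`.
  have h₂ := realizes_of_iso (X.realize_zero A D)
    { hom := (biprod.lift biprod.fst (biprod.desc (-f) (𝟙 D)) : A ⊞ D ⟶ A ⊞ D)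
      inv := biprod.lift biprod.fst (biprod.desc f (𝟙 D))
      hom_inv_id := by apply biprod.hom_ext' <;> apply biprod.hom_ext <;> simp
      inv_hom_id := by apply biprod.hom_ext' <;> apply biprod.hom_ext <;> simp }
  obtain ⟨E', h', d, e, δ'', hd, he, h₃, h₄, -, -⟩ := X.et4 h₂ (realizes_add_left h D)
  rw [← push_comp] at h₄
  have hz : (biprod.inl : A ⟶ A ⊞ D) ≫ biprod.lift biprod.fst (biprod.desc f (𝟙 D)) ≫ biprod.snd
      = f := by simp
  dsimp only at h₄
  rw [hz] at h₄
  obtain ⟨i, hi₁, hi₂⟩ := realizes_iso h₄ hE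
  have h₅ := realizes_of_iso_ends h₃ (Iso.refl _) i
  refine ⟨biprod.inl ≫ h' ≫ i.hom, ?_, ?_⟩
  · simp [hi₂, he]
  · have h₆ : X.Conflation _ _ := ⟨_, h₅⟩
    convert h₆ using 1
    · apply biprod.hom_ext <;> simp
    · have : biprod.inr ≫ h' = d := by
        simpa using biprod.inr ≫= hd
      apply biprod.hom_ext' <;> simp [reassoc_of% this, hi₁]

end ExtriangulatedCategory

namespace CotorsionPair

open ExtriangulatedCategory
open scoped ZeroObject

variable {𝓑 : Type u} [Category.{v} 𝓑] [Preadditive 𝓑] [HasZeroObject 𝓑] [HasBinaryBiproducts 𝓑]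
  {X : ExtriangulatedCategory.{w} 𝓑} {P : CotorsionPair X}

/-! ### Conflations with an end term in `U` or `V`: cancellation modulo `W`, closure of `𝓑⁺` and
`𝓑⁻`. -/

section

variable {A B C : 𝓑} {f : A ⟶ B} {q : B ⟶ C} {δ : X.Ext C A}

/-- Maps into `W'` extend along `f`, since `𝔼(C, W') = 0`. Subtracting such an extension from `g`
leaves a map that kills `f`, hence comes from `C`; and maps from `U` to an object of `𝓑⁺` factor
through `W'`. -/
lemma factors_of_cone_U (h : X.Realizes f q δ) (hC : P.U C) {Y : 𝓑} (hY : P.Bplus Y) (g : B ⟶ Y)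
    (hg : P.Factors (f ≫ g)) : P.Factors g := by
  obtain ⟨V', W', i, p, hV', hW', l, hl⟩ := hY
  obtain ⟨D, a, b, hD, hab⟩ := hg
  obtain ⟨b', rfl⟩ := lift_of_pull_eq_zero hl b (P.ext_eq_zero hD.1 hV' _)
  obtain ⟨k, hk⟩ := extend_of_push_eq_zero h (a ≫ b') (P.ext_eq_zero hC hW'.2 _)
  obtain ⟨c, hc⟩ := desc_of_comp_eq_zero h (g - k ≫ p)
    (by rw [Preadditive.comp_sub, reassoc_of% hk, ← hab, sub_self])
  obtain ⟨c', rfl⟩ := lift_of_pull_eq_zero hl c (P.ext_eq_zero hC hV' _)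
  exact ⟨W', q ≫ c' + k, p, hW', by simp [hc]⟩

lemma factors_of_fiber_V (h : X.Realizes f q δ) (hA : P.V A) {Y : 𝓑} (hY : P.Bminus Y) (g : Y ⟶ B)
    (hg : P.Factors (g ≫ q)) : P.Factors g := by
  obtain ⟨W', U', i, p, hW', hU', l, hl⟩ := hY
  obtain ⟨D, a, b, hD, hab⟩ := hg
  obtain ⟨a', rfl⟩ := extend_of_push_eq_zero hl a (P.ext_eq_zero hU' hD.2 _)
  obtain ⟨k, hk⟩ := lift_of_pull_eq_zero h (a' ≫ b) (P.ext_eq_zero hW'.1 hA _)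
  obtain ⟨c, hc⟩ := lift_of_comp_eq_zero h (g - i ≫ k)
    (by rw [Preadditive.sub_comp, Category.assoc, hk, ← hab, Category.assoc, sub_self])
  obtain ⟨c', rfl⟩ := extend_of_push_eq_zero hl c (P.ext_eq_zero hU' hA _)
  exact ⟨W', i, c' ≫ f + k, hW', by
    rw [Preadditive.comp_add, ← Category.assoc, hc, sub_add_cancel]⟩

/-- `𝓑⁻` is closed under extensions by objects of `U` on the right. -/
lemma Bminus_of_extension (h : X.Realizes f q δ) (hA : P.Bminus A) (hC : P.U C) : P.Bminus B := by
  obtain ⟨W', U', i, p, hW', hU', l, hl⟩ := hA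
  obtain ⟨T, S, x, y, hT, hS, θ, hθ⟩ := P.exists_right B
  obtain ⟨k, hk⟩ := extend_of_push_eq_zero hl (f ≫ x) (P.ext_eq_zero hU' hT _)
  -- Only `T ∈ U` is at stake. An extension of `T` by `V'` dies on `A`, because `A ⟶ T` passes
  -- through `W'`; it then dies on `B`, since `𝔼(C, V') = 0`, and finally comes from `𝔼(S, V') = 0`.
  refine ⟨T, S, x, y, ⟨mem_U_of_ext fun V' hV' ε => ?_, hT⟩, hS, θ, hθ⟩
  have h₁ : X.pull f (X.pull x ε) = 0 := by
    rw [← pull_comp, ← hk, pull_comp, P.ext_eq_zero hW'.1 hV' (X.pull k ε), pull_zero']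
  obtain ⟨ε₁, hε₁⟩ := exists_pull_of_pull_eq_zero h _ h₁
  have h₂ : X.pull x ε = 0 := by rw [← hε₁, P.ext_eq_zero hC hV' ε₁, pull_zero']
  obtain ⟨ε₂, rfl⟩ := exists_pull_of_pull_eq_zero hθ _ h₂
  rw [P.ext_eq_zero hS hV' ε₂, pull_zero']

/-- `𝓑⁺` is closed under extensions by objects of `V` on the left. -/
lemma Bplus_of_extension (h : X.Realizes f q δ) (hA : P.V A) (hC : P.Bplus C) : P.Bplus B := by
  obtain ⟨V', W', i, p, hV', hW', l, hl⟩ := hC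
  obtain ⟨V₁, U₁, x, y, hV₁, hU₁, θ, hθ⟩ := P.exists_left B
  obtain ⟨k, hk⟩ := lift_of_pull_eq_zero hl (y ≫ q) (P.ext_eq_zero hU₁ hV' _)
  refine ⟨V₁, U₁, x, y, hV₁, ⟨hU₁, mem_V_of_ext fun U' hU' ε => ?_⟩, θ, hθ⟩
  have h₁ : X.push q (X.push y ε) = 0 := by
    rw [← push_comp, ← hk, push_comp, P.ext_eq_zero hU' hW'.2 (X.push k ε), push_zero']
  obtain ⟨ε₁, hε₁⟩ := exists_push_of_push_eq_zero h _ h₁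
  have h₂ : X.push y ε = 0 := by rw [← hε₁, P.ext_eq_zero hU' hA ε₁, push_zero']
  obtain ⟨ε₂, rfl⟩ := exists_push_of_push_eq_zero hθ _ h₂
  rw [P.ext_eq_zero hU' hV₁ ε₂, push_zero']

/-- The composite inflation `A ⟶ B ⟶ W'` has as cone an extension of `U'` by `C`, which is again in
`U`. -/
lemma Bminus_of_cone_U (h : X.Realizes f q δ) (hB : P.Bminus B) (hC : P.U C) : P.Bminus A := by
  obtain ⟨W', U', i, p, hW', hU', l, hl⟩ := hB
  obtain ⟨E, h', d, e, δ'', -, -, h₁, h₂, -, -⟩ := X.et4 h hl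
  exact ⟨W', E, _, _, hW', U_of_extension h₂ hC hU', _, h₁⟩

lemma Bplus_of_fiber_V (h : X.Realizes f q δ) (hB : P.Bplus B) (hA : P.V A) : P.Bplus C := by
  obtain ⟨V', W', i, p, hV', hW', l, hl⟩ := hB
  obtain ⟨E, h', d, e, δ'', -, -, h₁, h₂, -, -⟩ := X.et4op hl h
  exact ⟨E, W', _, _, V_of_extension h₂ hV' hA, hW', _, h₁⟩

end

lemma ext_eq_zero_of_factors_id {A : 𝓑} (h : P.Factors (𝟙 A)) :
    (∀ V', P.V V' → ∀ δ : X.Ext A V', δ = 0) ∧ (∀ U', P.U U' → ∀ δ : X.Ext U' A, δ = 0) := by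
  obtain ⟨D, i, p, hD, hip⟩ := h
  refine ⟨fun V' hV' δ => ?_, fun U' hU' δ => ?_⟩
  · rw [← X.pull_id δ, ← hip, pull_comp, P.ext_eq_zero hD.1 hV' (X.pull p δ), pull_zero']
  · rw [← X.push_id δ, ← hip, push_comp, P.ext_eq_zero hU' hD.2 (X.push i δ), push_zero']

variable (P)

/-! ### The heart -/

/-- An object of `𝓑⁺ ∩ 𝓑⁻` as an object of the heart. -/
abbrev heartObj (A : 𝓑) (hA : P.Bplus A ∧ P.Bminus A) : P.Heart := ⟨P.π.obj A, hA⟩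

variable {P}

/-- The morphism of the heart represented by a morphism of `𝓑`. -/
abbrev heartMap {A B : 𝓑} {hA : P.Bplus A ∧ P.Bminus A} {hB : P.Bplus B ∧ P.Bminus B} (f : A ⟶ B) :
    P.heartObj A hA ⟶ P.heartObj B hB :=
  ObjectProperty.homMk (P.π.map f)

section

variable {A B : 𝓑} {hA : P.Bplus A ∧ P.Bminus A} {hB : P.Bplus B ∧ P.Bminus B}

lemma heartMap_eq_iff (f g : A ⟶ B) :
    (heartMap f : P.heartObj A hA ⟶ P.heartObj B hB) = heartMap g ↔ P.Factors (f - g) := by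
  rw [← π_map_eq_iff]
  exact ⟨fun h => congrArg (fun k => k.hom) h, fun h => ObjectProperty.hom_ext _ h⟩

lemma heartMap_surjective (F : P.heartObj A hA ⟶ P.heartObj B hB) :
    ∃ f : A ⟶ B, heartMap f = F := by
  obtain ⟨f, hf⟩ := P.π.map_surjective F.hom
  exact ⟨f, ObjectProperty.hom_ext _ hf⟩

lemma heartMap_comp {C : 𝓑} {hC : P.Bplus C ∧ P.Bminus C} (f : A ⟶ B) (g : B ⟶ C) :
    (heartMap f : P.heartObj A hA ⟶ P.heartObj B hB) ≫
      (heartMap g : P.heartObj B hB ⟶ P.heartObj C hC) = heartMap (f ≫ g) :=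
  ObjectProperty.hom_ext _ (P.π.map_comp f g).symm

lemma heartMap_id : (heartMap (𝟙 A) : P.heartObj A hA ⟶ P.heartObj A hA) = 𝟙 _ :=
  ObjectProperty.hom_ext _ (P.π.map_id A)

lemma epi_heartMap_iff (f : A ⟶ B) :
    Epi (heartMap f : P.heartObj A hA ⟶ P.heartObj B hB) ↔
      ∀ (Y : 𝓑) (_ : P.Bplus Y ∧ P.Bminus Y) (g : B ⟶ Y), P.Factors (f ≫ g) → P.Factors g := by
  constructor
  · intro _ Y hY g hg
    have h : (heartMap f : P.heartObj A hA ⟶ P.heartObj B hB) ≫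
        (heartMap g : _ ⟶ P.heartObj Y hY) = heartMap f ≫ (heartMap 0 : P.heartObj B hB ⟶ _) := by
      rw [heartMap_comp, heartMap_comp, heartMap_eq_iff, comp_zero, sub_zero]
      exact hg
    rw [cancel_epi, heartMap_eq_iff, sub_zero] at h
    exact h
  · intro h
    refine ⟨fun {Y} g g' hgg' => ?_⟩
    obtain ⟨⟨Y⟩, hY⟩ := Y
    obtain ⟨g, rfl⟩ := heartMap_surjective (hA := hB) (hB := hY) g
    obtain ⟨g', rfl⟩ := heartMap_surjective (hA := hB) (hB := hY) g'
    erw [heartMap_comp, heartMap_comp, heartMap_eq_iff, ← Preadditive.comp_sub] at hgg'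
    exact (heartMap_eq_iff g g').2 (h Y hY _ hgg')

lemma mono_heartMap_iff (f : A ⟶ B) :
    Mono (heartMap f : P.heartObj A hA ⟶ P.heartObj B hB) ↔
      ∀ (Y : 𝓑) (_ : P.Bplus Y ∧ P.Bminus Y) (g : Y ⟶ A), P.Factors (g ≫ f) → P.Factors g := by
  constructor
  · intro _ Y hY g hg
    have h : (heartMap g : P.heartObj Y hY ⟶ P.heartObj A hA) ≫
        (heartMap f : _ ⟶ P.heartObj B hB) = (heartMap 0 : _ ⟶ P.heartObj A hA) ≫ heartMap f := by
      rw [heartMap_comp, heartMap_comp, heartMap_eq_iff, zero_comp, sub_zero]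
      exact hg
    rw [cancel_mono, heartMap_eq_iff, sub_zero] at h
    exact h
  · intro h
    refine ⟨fun {Y} g g' hgg' => ?_⟩
    obtain ⟨⟨Y⟩, hY⟩ := Y
    obtain ⟨g, rfl⟩ := heartMap_surjective (hA := hY) (hB := hA) g
    obtain ⟨g', rfl⟩ := heartMap_surjective (hA := hY) (hB := hA) g'
    erw [heartMap_comp, heartMap_comp, heartMap_eq_iff, ← Preadditive.sub_comp] at hgg'
    exact (heartMap_eq_iff g g').2 (h Y hY _ hgg')

lemma isZero_heartObj_iff : IsZero (P.heartObj A hA) ↔ P.Factors (𝟙 A) := by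
  constructor
  · intro h
    have := h.eq_of_src (heartMap (𝟙 A) : P.heartObj A hA ⟶ P.heartObj A hA) (heartMap 0)
    rwa [heartMap_eq_iff, sub_zero] at this
  · intro h
    refine ⟨fun Y => ⟨⟨⟨?_⟩, fun f => ?_⟩⟩, fun Y => ⟨⟨⟨?_⟩, fun f => ?_⟩⟩⟩
    · exact (heartMap (0 : A ⟶ Y.obj.as) : P.heartObj A hA ⟶ P.heartObj _ Y.property)
    · obtain ⟨f, rfl⟩ := heartMap_surjective (hA := hA) (hB := Y.property) f
      refine (heartMap_eq_iff _ _).2 ?_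
      simpa using h.postcomp f
    · exact (heartMap (0 : Y.obj.as ⟶ A) : P.heartObj _ Y.property ⟶ P.heartObj A hA)
    · obtain ⟨f, rfl⟩ := heartMap_surjective (hA := Y.property) (hB := hA) f
      refine (heartMap_eq_iff _ _).2 ?_
      simpa using h.precomp f

/-! ### The heart is balanced -/

/-- If `f` is an epimorphism in the heart, then the cone `M` of a pushout `A ⟶ W' ⊞ B ⟶ M` lies
in `U`. -/
lemma mem_U_of_epi (f : A ⟶ B) [Epi (heartMap f : P.heartObj A hA ⟶ P.heartObj B hB)]
    {M U' : 𝓑} {m : B ⟶ M} {q : M ⟶ U'} {μ : X.Ext U' B} (h : X.Realizes m q μ) (hU' : P.U U')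
    (hf : P.Factors (f ≫ m)) : P.U M := by
  have hM := Bminus_of_extension h hB.2 hU'
  have hr := P.isReflectionSeq_plus M
  obtain ⟨ρ, hρ⟩ := hr.conflation
  -- `M⁺` lies in the heart and `f` kills the map `B ⟶ M⁺`, so this map vanishes modulo `W`.
  -- Cancelling `m` and then the reflection shows that `M⁺` itself vanishes in `𝓑 / W`. Extensions
  -- of `M` by `V` are restricted from `M⁺`, hence are zero.
  have h₁ : P.Factors (m ≫ P.toPlus M) :=
    (epi_heartMap_iff (hA := hA) (hB := hB) f).1 inferInstance _
      ⟨hr.hZ, Bminus_of_extension hρ hM hr.hS⟩ _ (by simpa using hf.postcomp (P.toPlus M))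
  have h₂ : P.Factors (𝟙 (P.plus M)) :=
    hr.factors hr.hZ _ (by simpa using factors_of_cone_U h hU' hr.hZ _ h₁)
  refine mem_U_of_ext fun V' hV' ε => ?_
  obtain ⟨β, rfl⟩ := hr.surj V' hV' ε
  obtain rfl := (ext_eq_zero_of_factors_id h₂).1 V' hV' β
  exact pull_zero' X _

/-- Dual to `mem_U_of_epi`: the coreflection of `N` vanishes in `𝓑 / W`, and extensions of `U` by
`N` are pushed forward from it. -/
lemma mem_V_of_mono (f : A ⟶ B) [Mono (heartMap f : P.heartObj A hA ⟶ P.heartObj B hB)]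
    {N V' : 𝓑} {j : V' ⟶ N} {n : N ⟶ A} {ν : X.Ext A V'} (h : X.Realizes j n ν) (hV' : P.V V')
    (hf : P.Factors (n ≫ f)) : P.V N := by
  have hN := Bplus_of_extension h hV' hA.1
  have hr := P.isCoreflectionSeq_minus N
  have h₁ : P.Factors (P.fromMinus N ≫ n) :=
    (mono_heartMap_iff (hA := hA) (hB := hB) f).1 inferInstance _
      ⟨hr.bplus hN, hr.hZ⟩ _ (by simpa using hf.precomp (P.fromMinus N))
  have h₂ : P.Factors (𝟙 (P.minus N)) :=
    hr.factors hr.hZ _ (by simpa using factors_of_fiber_V h hV' hr.hZ _ h₁)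
  refine mem_V_of_ext fun U' hU' ε => ?_
  obtain ⟨β, rfl⟩ := hr.surj U' hU' ε
  obtain rfl := (ext_eq_zero_of_factors_id h₂).2 U' hU' β
  exact push_zero' X _

/-- Being epi and mono provides conflations `A ⟶ W₁ ⊞ B ⟶ M` and `N ⟶ A ⊞ W₂ ⟶ B` with `M ∈ U` and
`N ∈ V`. The class of the first, pushed to `A ⊞ W₂`, comes from `𝔼(M, N) = 0`. So the first
conflation splits, and the retraction restricted to `B` is, up to sign, a left inverse of `f` modulo
`W`. -/
lemma isIso_heartMap (f : A ⟶ B) (_ : Mono (heartMap f : P.heartObj A hA ⟶ P.heartObj B hB))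
    (_ : Epi (heartMap f : P.heartObj A hA ⟶ P.heartObj B hB)) :
    IsIso (heartMap f : P.heartObj A hA ⟶ P.heartObj B hB) := by
  obtain ⟨W₁, U₁, i, p, hW₁, hU₁, l, hl⟩ := hA.2
  obtain ⟨M, m, q, hM⟩ := X.exists_realizes (X.push f l)
  obtain ⟨k, -, δ, hδ⟩ := exists_conflation_of_push hl f hM
  have hMU : P.U M := mem_U_of_epi (hA := hA) (hB := hB) f hM hU₁
    ⟨W₁, i, k, hW₁, by simpa [sub_eq_zero, ← sub_eq_add_neg] using comp_eq_zero hδ⟩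
  obtain ⟨V₂, W₂, j, r, hV₂, hW₂, t, ht⟩ := hB.1
  obtain ⟨N, a, n, hN⟩ := X.exists_realizes (X.pull f t)
  obtain ⟨k', -, ε, hε⟩ := exists_conflation_of_pull ht f hN
  have hNV : P.V N := mem_V_of_mono (hA := hA) (hB := hB) f hN hV₂
    ⟨W₂, k', r, hW₂, by
      have := comp_eq_zero hε
      rw [biprod.lift_desc, Preadditive.comp_neg, neg_add_eq_zero] at this
      exact this.symm⟩
  -- Pushed on to `B`, the class becomes `(-f)_* δ`, which vanishes because `-f` is a component of
  -- the inflation realizing `δ`.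
  have h₁ : X.push (biprod.inl : A ⟶ A ⊞ W₂) δ = 0 := by
    obtain ⟨δ', hδ'⟩ := exists_push_of_push_eq_zero hε (X.push biprod.inl δ) (by
      have : (biprod.inl : A ⟶ A ⊞ W₂) ≫ biprod.desc (-f) r = biprod.lift i (-f) ≫ biprod.snd := by
        simp
      rw [← push_comp, this, push_comp, push_eq_zero hδ, push_zero'])
    rw [← hδ', P.ext_eq_zero hMU hNV δ', push_zero']
  have h₂ : δ = 0 := by
    have := congrArg (X.push biprod.fst) h₁
    rwa [← push_comp, biprod.inl_fst, push_id, push_zero'] at this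
  obtain ⟨s, hs⟩ := extend_of_push_eq_zero hδ (𝟙 A) (by rw [h₂, push_zero'])
  have h₃ : (heartMap f : P.heartObj A hA ⟶ P.heartObj B hB) ≫
      (heartMap (-(biprod.inr ≫ s)) : P.heartObj B hB ⟶ P.heartObj A hA) = 𝟙 _ := by
    rw [heartMap_comp, ← heartMap_id, heartMap_eq_iff]
    refine ⟨W₁, -i, biprod.inl ≫ s, hW₁, ?_⟩
    rw [← hs, biprod.lift_eq]
    simp
  have : IsSplitMono (heartMap f : P.heartObj A hA ⟶ P.heartObj B hB) := IsSplitMono.mk' ⟨_, h₃⟩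
  exact isIso_of_epi_of_isSplitMono _

end

variable (P)

/-! ### The functor `H` on morphisms -/

lemma unitMap_sigmaPlus_map {A B : P.Quot} (f : A ⟶ B) :
    P.unitMap A ≫ (P.sigmaPlus.map f).hom = f ≫ P.unitMap B :=
  (Equiv.apply_symm_apply (P.plusEquiv A (P.plusObj B)) _).trans (by simp [plusEquiv])

lemma sigmaMinus_map_counitMap {A B : P.Quot} (f : A ⟶ B) :
    (P.sigmaMinus.map f).hom ≫ P.counitMap B = P.counitMap A ≫ f :=
  (Equiv.symm_apply_apply (P.minusEquiv (P.minusObj A) B) _).trans (by simp [minusEquiv])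

lemma Hobj_mem (B : 𝓑) :
    P.Bplus (P.minus (P.plus B)) ∧ P.Bminus (P.minus (P.plus B)) :=
  P.sigma_mem_heart (P.π.obj B)

/-- Gives representatives in `𝓑`, so that mono and epi properties of `H f` can be checked by
factorizations through `W`. -/
lemma exists_H_map {A B : 𝓑} (f : A ⟶ B) :
    ∃ (f' : P.plus A ⟶ P.plus B) (h : P.minus (P.plus A) ⟶ P.minus (P.plus B)),
      P.π.map (P.toPlus A ≫ f') = P.π.map (f ≫ P.toPlus B) ∧
      P.π.map (h ≫ P.fromMinus (P.plus B)) = P.π.map (P.fromMinus (P.plus A) ≫ f') ∧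
      P.H.map f = (heartMap h : P.heartObj _ (P.Hobj_mem A) ⟶ P.heartObj _ (P.Hobj_mem B)) := by
  obtain ⟨f', hf'⟩ := P.π.map_surjective (P.sigmaPlus.map (P.π.map f)).hom
  obtain ⟨h, hh⟩ : ∃ h : P.minus (P.plus A) ⟶ P.minus (P.plus B),
      P.π.map h = (P.sigmaMinus.map (P.sigmaPlus.map (P.π.map f)).hom).hom :=
    P.π.map_surjective _
  refine ⟨f', h, ?_, ?_, ?_⟩
  · rw [Functor.map_comp, Functor.map_comp, hf']
    exact P.unitMap_sigmaPlus_map (P.π.map f)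
  · rw [Functor.map_comp, Functor.map_comp, hf', hh]
    exact P.sigmaMinus_map_counitMap (P.sigmaPlus.map (P.π.map f)).hom
  · exact ObjectProperty.hom_ext _ hh.symm

variable {P}

lemma isZero_H_iff (B : 𝓑) : IsZero (P.H.obj B) ↔ P.Factors (𝟙 (P.minus (P.plus B))) :=
  isZero_heartObj_iff (hA := P.Hobj_mem B)

/-! ### Criteria for epimorphisms and monomorphisms -/

/-- The composite `A ⟶ B ⟶ B⁺` has cone in `U`. Pulling it back along `(B⁺)⁻ ⟶ B⁺` gives an
inflation `a'` with the same cone: hence `A' ∈ 𝓑⁻`, and `a'` can be cancelled modulo `W`. -/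
lemma exists_lift_fromMinus {A B C : 𝓑} {s : A ⟶ B} {q : B ⟶ C} {δ : X.Ext C A}
    (hs : X.Realizes s q δ) (hC : P.U C) :
    ∃ (A' : 𝓑) (a : A' ⟶ A) (a' : A' ⟶ P.minus (P.plus B)), P.Bminus A' ∧
      a' ≫ P.fromMinus (P.plus B) = a ≫ s ≫ P.toPlus B ∧
      ∀ (Y : 𝓑), P.Bplus Y → ∀ g : P.minus (P.plus B) ⟶ Y, P.Factors (a' ≫ g) → P.Factors g := by
  have hr := P.isReflectionSeq_plus B
  have hc := P.isCoreflectionSeq_minus (P.plus B)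
  obtain ⟨ρ, hρ⟩ := hr.conflation
  obtain ⟨ν, hν⟩ := hc.conflation
  obtain ⟨E, q', d, e, δ₁, -, -, h₁, h₂, -, -⟩ := X.et4 hs hρ
  have hE : P.U E := U_of_extension h₂ hC hr.hS
  obtain ⟨A', a', d', a, δ₂, -, h₃, h₄, -, -, -⟩ := X.et4op hν h₁
  exact ⟨A', a, a', Bminus_of_cone_U h₄ hc.hZ hE, h₃, fun Y hY g => factors_of_cone_U h₄ hE hY g⟩

/-- The map `A' ⟶ D ⟶ B` lifts through `f`, and then to `(A⁺)⁻`. By uniqueness of lifts to a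
coreflection, `a'` factors through `h` modulo `W`; since `a'` is cancellable, so is `h`. -/
lemma epi_H_map_of_lift {A B D C : 𝓑} (f : A ⟶ B) {s : D ⟶ B} {q : B ⟶ C} {δ : X.Ext C D}
    (hs : X.Realizes s q δ) (hC : P.U C)
    (hlift : ∀ Y, P.Bminus Y → ∀ a : Y ⟶ D, ∃ b : Y ⟶ A, b ≫ f = a ≫ s) : Epi (P.H.map f) := by
  obtain ⟨f', h, h₁, h₂, h₃⟩ := P.exists_H_map f
  rw [h₃]
  refine (epi_heartMap_iff (hA := P.Hobj_mem A) (hB := P.Hobj_mem B) h).2 fun Y hY g hg => ?_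
  obtain ⟨A', a, a', hA', ha, hcancel⟩ := exists_lift_fromMinus hs hC
  obtain ⟨b, hb⟩ := hlift A' hA' a
  obtain ⟨b', hb'⟩ := (P.isCoreflectionSeq_minus (P.plus A)).exists_lift hA' (b ≫ P.toPlus A)
  have h₄ : P.Factors (b' ≫ h - a') := by
    refine (P.isCoreflectionSeq_minus (P.plus B)).factors hA' _ ?_
    rw [← π_map_eq_iff] at hb'
    rw [Preadditive.sub_comp, ← π_map_eq_iff, ha, ← reassoc_of% hb]
    simp only [Functor.map_comp] at h₁ h₂ hb' ⊢
    rw [Category.assoc, h₂, reassoc_of% hb', h₁]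
  refine hcancel Y hY.1 g ?_
  have h₅ : a' ≫ g = b' ≫ h ≫ g + -((b' ≫ h - a') ≫ g) := by simp
  rw [h₅]
  exact (hg.precomp b').add (h₄.postcomp g).neg

/-- Let `E` be the cone of `A ⟶ B ⟶ B⁺`; it lies in `𝓑⁺`. The hypothesis makes the deflation `t' :
B⁺ ⟶ E` factor through `f'` modulo `W`. A map `g` killed by `h` is then killed by `(B⁺)⁻ ⟶ B⁺ ⟶ E`,
and both arrows can be cancelled on maps from `𝓑⁻`. -/
lemma mono_H_map_of_extend {A B C D : 𝓑} (f : B ⟶ C) {i : A ⟶ B} {t : B ⟶ D} {δ : X.Ext D A}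
    (ht : X.Realizes i t δ) (hA : P.V A)
    (hext : ∀ Y, P.Bplus Y → ∀ c : D ⟶ Y, ∃ e : C ⟶ Y, f ≫ e = t ≫ c) : Mono (P.H.map f) := by
  obtain ⟨f', h, h₁, h₂, h₃⟩ := P.exists_H_map f
  rw [h₃]
  refine (mono_heartMap_iff (hA := P.Hobj_mem B) (hB := P.Hobj_mem C) h).2 fun Y hY g hg => ?_
  have hr := P.isReflectionSeq_plus B
  obtain ⟨ρ, hρ⟩ := hr.conflation
  obtain ⟨E, t', c, e, δ₁, hc, -, h₄, -, -, -⟩ := X.et4 ht hρ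
  have hE := Bplus_of_fiber_V h₄ hr.hZ hA
  obtain ⟨b, hb⟩ := hext E hE c
  obtain ⟨b', hb'⟩ := (P.isReflectionSeq_plus C).exists_lift hE b
  have h₅ : P.Factors (f' ≫ b' - t') := by
    refine hr.factors hE _ ?_
    rw [← π_map_eq_iff] at hb'
    rw [Preadditive.comp_sub, ← π_map_eq_iff, hc, ← hb]
    simp only [Functor.map_comp] at h₁ hb' ⊢
    rw [reassoc_of% h₁, hb']
  refine (P.isCoreflectionSeq_minus (P.plus B)).factors hY.2 g
    (factors_of_fiber_V h₄ hA hY.2 _ ?_)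
  have h₆ : P.Factors ((g ≫ P.fromMinus (P.plus B)) ≫ f' ≫ b') := by
    have h₇ : P.Factors (g ≫ P.fromMinus (P.plus B) ≫ f') := by
      have := hg.postcomp (P.fromMinus (P.plus C))
      rw [← sub_zero (g ≫ P.fromMinus (P.plus B) ≫ f'), ← π_map_eq_iff]
      rw [← sub_zero ((g ≫ h) ≫ _), ← π_map_eq_iff] at this
      rw [← this]
      simp only [Functor.map_comp] at h₂ ⊢
      rw [Category.assoc, h₂]
    simpa using h₇.postcomp b'
  have h₈ : (g ≫ P.fromMinus (P.plus B)) ≫ t' = (g ≫ P.fromMinus (P.plus B)) ≫ f' ≫ b' +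
      -((g ≫ P.fromMinus (P.plus B)) ≫ (f' ≫ b' - t')) := by simp
  rw [h₈]
  exact h₆.add (h₅.precomp _).neg

section

variable {A B C : 𝓑} {f : A ⟶ B} {q : B ⟶ C} {δ : X.Ext C A}

lemma epi_H_of_cone_U (h : X.Realizes f q δ) (hC : P.U C) : Epi (P.H.map f) :=
  epi_H_map_of_lift f h hC fun _ _ a => ⟨a, rfl⟩

lemma mono_H_of_fiber_V (h : X.Realizes f q δ) (hA : P.V A) : Mono (P.H.map q) :=
  mono_H_map_of_extend q h hA fun _ _ c => ⟨c, rfl⟩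

/-- Pull back along `V₁ ⟶ U₁ ⟶ C`, so that `f` is `x` followed by `k`. The cone of `x` is in `U`.
Maps from `𝓑⁻` to `B` lift through `k`: followed by `q` they extend to `W'`, since `𝔼(U', C) = 0`,
and then lift to `U₁`, since `𝔼(W', V₁) = 0`. -/
lemma epi_H_of_cone_V (h : X.Realizes f q δ) (hC : P.V C) : Epi (P.H.map f) := by
  obtain ⟨V₁, U₁, i, p, hV₁, hU₁, θ, hθ⟩ := P.exists_left C
  obtain ⟨B₁, x, y, hB₁⟩ := X.exists_realizes (X.pull p δ)
  obtain ⟨k, hk, ε, hε⟩ := exists_conflation_of_pull h p hB₁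
  have h₁ : Epi (P.H.map x) := epi_H_of_cone_U hB₁ hU₁
  have h₂ : Epi (P.H.map k) := by
    refine epi_H_map_of_lift k (X.realizes_id_zero B (isZero_zero 𝓑))
      (P.hU.zero (isZero_zero 𝓑)) fun Y hY a => ?_
    obtain ⟨W', U', j, r, hW', hU', l, hl⟩ := hY
    obtain ⟨b, hb⟩ := extend_of_push_eq_zero hl (a ≫ q) (P.ext_eq_zero hU' hC _)
    obtain ⟨b', rfl⟩ := lift_of_pull_eq_zero hθ b (P.ext_eq_zero hW'.1 hV₁ _)
    obtain ⟨m, hm⟩ := lift_of_comp_eq_zero hε (biprod.lift (j ≫ b') a) (by simp [hb])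
    exact ⟨m, by simpa using hm =≫ biprod.snd⟩
  rw [← hk, Functor.map_comp]
  infer_instance

lemma mono_H_of_fiber_U (h : X.Realizes f q δ) (hA : P.U A) : Mono (P.H.map q) := by
  obtain ⟨V₁, U₁, i, p, hV₁, hU₁, θ, hθ⟩ := P.exists_right A
  obtain ⟨B₁, x, y, hB₁⟩ := X.exists_realizes (X.push i δ)
  obtain ⟨k, hk, ε, hε⟩ := exists_conflation_of_push h i hB₁
  have h₁ : Mono (P.H.map y) := mono_H_of_fiber_V hB₁ hV₁
  have h₂ : Mono (P.H.map k) := by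
    refine mono_H_map_of_extend k (X.realizes_zero_id B (isZero_zero 𝓑))
      (P.hV.zero (isZero_zero 𝓑)) fun Y hY a => ?_
    obtain ⟨V', W', j, r, hV', hW', l, hl⟩ := hY
    obtain ⟨b, hb⟩ := lift_of_pull_eq_zero hl (f ≫ a) (P.ext_eq_zero hA hV' _)
    obtain ⟨b', rfl⟩ := extend_of_push_eq_zero hθ b (P.ext_eq_zero hU₁ hW'.2 _)
    obtain ⟨m, hm⟩ := desc_of_comp_eq_zero hε (biprod.desc a (b' ≫ r))
      (by simp [← hb])
    exact ⟨m, by simpa using biprod.inl ≫= hm⟩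
  rw [← hk, Functor.map_comp]
  infer_instance

/-- `H` sends an inflation whose cone lies in the kernel to an epimorphism. -/
lemma epi_H_of_cone_kernel (h : X.Realizes f q δ) (hC : P.kernel C) : Epi (P.H.map f) := by
  obtain ⟨C', U₁, V₁, i, p, hU₁, hV₁, θ, hθ⟩ := hC
  -- Adding `C'` to `B` and `C` gives a cone in `U ∗ V`. The inflation then splits into one with
  -- cone `U₁` and one with cone `V₁`; the projection back to `B` is split epi.
  obtain ⟨E, h', d, e, ε, hd, -, h₁, h₂, -, -⟩ := X.et4op (realizes_add_right h C') hθ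
  have := epi_H_of_cone_U h₂ hU₁
  have := epi_H_of_cone_V h₁ hV₁
  have hf : f = d ≫ h' ≫ biprod.fst := by rw [reassoc_of% hd]; simp
  rw [hf, Functor.map_comp, Functor.map_comp]
  infer_instance

/-- `H` sends a deflation whose fiber lies in the kernel to a monomorphism. -/
lemma mono_H_of_fiber_kernel (h : X.Realizes f q δ) (hA : P.kernel A) : Mono (P.H.map q) := by
  obtain ⟨A', U₁, V₁, i, p, hU₁, hV₁, θ, hθ⟩ := hA
  obtain ⟨E, h', d, e, ε, -, he, h₁, h₂, -, -⟩ := X.et4 hθ (realizes_add_left h A')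
  have := mono_H_of_fiber_U h₁ hU₁
  have := mono_H_of_fiber_V h₂ hV₁
  have hq : q = biprod.inl ≫ h' ≫ e := by rw [he]; simp
  rw [hq, Functor.map_comp, Functor.map_comp]
  infer_instance

end

/-! ### The kernel -/

lemma kernel_of_U {A : 𝓑} (hA : P.U A) : P.kernel A := by
  refine ⟨0, A ⊞ 0, 0, 𝟙 _, 0, P.hU.biprod hA (P.hU.zero (isZero_zero 𝓑)),
    P.hV.zero (isZero_zero 𝓑), 0, X.realizes_id_zero _ (isZero_zero 𝓑)⟩

lemma kernel_of_V {A : 𝓑} (hA : P.V A) : P.kernel A := by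
  refine ⟨0, 0, A ⊞ 0, 0, 𝟙 _, P.hU.zero (isZero_zero 𝓑),
    P.hV.biprod hA (P.hV.zero (isZero_zero 𝓑)), 0, X.realizes_zero_id _ (isZero_zero 𝓑)⟩

/-- A map from `U` to `𝓑⁺` factors through `W`; hence `A ⟶ A⁺` vanishes in `𝓑 / W`, and so does
`A⁺`. -/
lemma isZero_H_of_U {A : 𝓑} (hA : P.U A) : IsZero (P.H.obj A) := by
  have hr := P.isReflectionSeq_plus A
  have hc := P.isCoreflectionSeq_minus (P.plus A)
  have h₁ : P.Factors (P.toPlus A) := by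
    obtain ⟨V', W', i, p, hV', hW', l, hl⟩ := hr.hZ
    obtain ⟨k, hk⟩ := lift_of_pull_eq_zero hl (P.toPlus A) (P.ext_eq_zero hA hV' _)
    exact ⟨W', k, p, hW', hk⟩
  have h₂ : P.Factors (𝟙 (P.plus A)) := hr.factors hr.hZ _ (by simpa using h₁)
  rw [isZero_H_iff]
  exact hc.factors hc.hZ _ (by simpa using h₂.precomp (P.fromMinus (P.plus A)))

/-- `U₁ ⟶ B ⊞ B'` has cone in `V`, so `H B` receives an epimorphism from `H U₁ = 0`. -/
lemma isZero_H_of_kernel {B : 𝓑} (hB : P.kernel B) : IsZero (P.H.obj B) := by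
  obtain ⟨B', U₁, V₁, i, p, hU₁, hV₁, θ, hθ⟩ := hB
  have h₁ := epi_H_of_cone_V hθ hV₁
  have h₂ : Epi (P.H.map (i ≫ biprod.fst)) := by
    rw [Functor.map_comp]
    infer_instance
  obtain ⟨_, h, -, -, h₃⟩ := P.exists_H_map (i ≫ biprod.fst)
  rw [h₃] at h₂
  rw [isZero_H_iff]
  refine (epi_heartMap_iff (hA := P.Hobj_mem U₁) (hB := P.Hobj_mem B) h).1 h₂ _ (P.Hobj_mem B) _ ?_
  simpa using ((isZero_H_iff U₁).1 (isZero_H_of_U hU₁)).postcomp h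

/-- For a reflection sequence `B ⟶ Z ⟶ S` there is a conflation `U' ⟶ B ⊞ R ⟶ Z` with
`U' ∈ U`. -/
lemma IsReflectionSeq.exists_conflation {B Z S : 𝓑} {z : B ⟶ Z} {q : Z ⟶ S}
    (h : P.IsReflectionSeq z q) :
    ∃ (U' R : 𝓑) (a : U' ⟶ B ⊞ R) (r : R ⟶ Z), P.U U' ∧ X.Conflation a (biprod.desc (-z) r) := by
  obtain ⟨V', U', x, y, hV', hU', θ, hθ⟩ := P.exists_left B
  -- The surjectivity condition on reflection sequences makes `V' ⟶ U' ⟶ B` a pullback of a triangle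
  -- over `Z`.
  obtain ⟨θ', hθ'⟩ := h.surj V' hV' θ
  obtain rfl : X.pull z θ' = θ := hθ'
  obtain ⟨R, x', y', hR⟩ := X.exists_realizes θ'
  obtain ⟨k, -, hk⟩ := exists_conflation_of_pull hR z hθ
  exact ⟨U', R, _, y', hU', hk⟩

/-- For a coreflection sequence `V₀ ⟶ Z ⟶ B` there is a conflation `Z ⟶ R ⊞ B ⟶ V'` with
`V' ∈ V`. -/
lemma IsCoreflectionSeq.exists_conflation {V₀ Z B : 𝓑} {j : V₀ ⟶ Z} {z : Z ⟶ B}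
    (h : P.IsCoreflectionSeq j z) :
    ∃ (V' R : 𝓑) (a : R ⊞ B ⟶ V') (r : Z ⟶ R), P.V V' ∧ X.Conflation (biprod.lift r (-z)) a := by
  obtain ⟨V', U', x, y, hV', hU', θ, hθ⟩ := P.exists_right B
  obtain ⟨θ', hθ'⟩ := h.surj U' hU' θ
  obtain rfl : X.push z θ' = θ := hθ'
  obtain ⟨R, x', y', hR⟩ := X.exists_realizes θ'
  obtain ⟨k, -, hk⟩ := exists_conflation_of_push hR z hθ
  exact ⟨V', R, _, x', hV', hk⟩

/-- If `(B⁺)⁻` vanishes, then `𝔼(U, B⁺) = 0`, as these extensions come from `(B⁺)⁻`; so `B⁺ ∈ V`.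
The conflation `U' ⟶ B ⊞ R ⟶ B⁺` then exhibits `B` as a summand of an object of `U ∗ V`. -/
lemma kernel_of_isZero_H {B : 𝓑} (hB : IsZero (P.H.obj B)) : P.kernel B := by
  rw [isZero_H_iff] at hB
  have hV : P.V (P.plus B) := mem_V_of_ext fun U' hU' ε => by
    obtain ⟨β, rfl⟩ := (P.isCoreflectionSeq_minus (P.plus B)).surj U' hU' ε
    obtain rfl := (ext_eq_zero_of_factors_id hB).2 U' hU' β
    exact push_zero' X _
  obtain ⟨U', R, a, r, hU', h⟩ := (P.isReflectionSeq_plus B).exists_conflation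
  exact ⟨R, U', P.plus B, a, _, hU', hV, h⟩

lemma kernel_iff_isZero_H (B : 𝓑) : P.kernel B ↔ IsZero (P.H.obj B) :=
  ⟨isZero_H_of_kernel, kernel_of_isZero_H⟩

/-- The heart is balanced on the morphisms in the image of `H`. -/
lemma isIso_H_map {A B : 𝓑} (f : A ⟶ B) [Mono (P.H.map f)] [Epi (P.H.map f)] :
    IsIso (P.H.map f) := by
  obtain ⟨_, h, -, -, h₃⟩ := P.exists_H_map f
  have h₁ : Mono (P.H.map f) := inferInstance
  have h₂ : Epi (P.H.map f) := inferInstance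
  rw [h₃] at h₁ h₂ ⊢
  exact isIso_heartMap (hA := P.Hobj_mem A) (hB := P.Hobj_mem B) h h₁ h₂

variable (P) {P' : CotorsionPair X}

/-! ### The functor induced on a heart by the associated functor of another cotorsion pair -/

lemma unit_app_sigmaPlusAdj (B : P.Quot) : P.sigmaPlusAdj.unit.app B = P.unitMap B :=
  Category.comp_id (P.unitMap B)

lemma counit_app_sigmaMinusAdj (B : P.Quot) : P.sigmaMinusAdj.counit.app B = P.counitMap B :=
  Category.id_comp (P.counitMap B)

variable {P}

/-- Additivity of `H` is avoided: `f` and `g` are `(i, 1)` and `(0, 1)` followed by the same map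
from `D ⊞ A`. The projection `D ⊞ A ⟶ A`, monic under `H`, identifies these two. -/
lemma H_map_eq_of_kernel {A B D : 𝓑} {f g : A ⟶ B} (i : A ⟶ D) (p : D ⟶ B) (h : i ≫ p = f - g)
    (hD : P.kernel D) : P.H.map f = P.H.map g := by
  have := mono_H_of_fiber_kernel (X.realize_zero D A) hD
  have h₁ : P.H.map (biprod.lift i (𝟙 A)) = P.H.map (biprod.lift 0 (𝟙 A)) := by
    rw [← cancel_mono (P.H.map (biprod.snd : D ⊞ A ⟶ A)), ← Functor.map_comp, ← Functor.map_comp]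
    simp
  have hf : f = biprod.lift i (𝟙 A) ≫ biprod.desc p g := by simp [h]
  have hg : g = biprod.lift 0 (𝟙 A) ≫ biprod.desc p g := by simp
  calc P.H.map f = P.H.map (biprod.lift i (𝟙 A)) ≫ P.H.map (biprod.desc p g) := by
        rw [← Functor.map_comp, ← hf]
    _ = P.H.map g := by rw [h₁, ← Functor.map_comp, ← hg]

/-- The cone `S` makes `H' z` epi. The conflation `U' ⟶ B ⊞ R ⟶ Z`, restricted to the summand `B`,
makes `H'(-z)` mono, and the sign is absorbed by `-𝟙 Z`. The heart of `P'` is balanced. -/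
lemma isIso_H_map_of_reflection {B Z S : 𝓑} {z : B ⟶ Z} {q : Z ⟶ S} (h : P.IsReflectionSeq z q)
    (hU : ∀ A, P.U A → P'.kernel A) : IsIso (P'.H.map z) := by
  obtain ⟨ρ, hρ⟩ := h.conflation
  have := epi_H_of_cone_kernel hρ (hU _ h.hS)
  obtain ⟨U', R, a, r, hU', ε, hε⟩ := h.exists_conflation
  have := mono_H_of_fiber_kernel hε (hU _ hU')
  have h₁ : Mono (P'.H.map z ≫ P'.H.map (-𝟙 Z)) := by
    have : z ≫ (-𝟙 Z) = biprod.inl ≫ biprod.desc (-z) r := by simp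
    rw [← Functor.map_comp, this, Functor.map_comp]
    infer_instance
  have := mono_of_mono (P'.H.map z) (P'.H.map (-𝟙 Z))
  exact isIso_H_map z

lemma isIso_H_map_of_coreflection {V₀ Z B : 𝓑} {j : V₀ ⟶ Z} {z : Z ⟶ B}
    (h : P.IsCoreflectionSeq j z) (hV : ∀ A, P.V A → P'.kernel A) : IsIso (P'.H.map z) := by
  obtain ⟨ν, hν⟩ := h.conflation
  have := mono_H_of_fiber_kernel hν (hV _ h.hV)
  obtain ⟨V', R, a, r, hV', ε, hε⟩ := h.exists_conflation
  have := epi_H_of_cone_kernel hε (hV _ hV')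
  have h₁ : Epi (P'.H.map (-𝟙 Z) ≫ P'.H.map z) := by
    have : (-𝟙 Z) ≫ z = biprod.lift r (-z) ≫ biprod.snd := by simp
    rw [← Functor.map_comp, this, Functor.map_comp]
    infer_instance
  have := epi_of_epi (P'.H.map (-𝟙 Z)) (P'.H.map z)
  exact isIso_H_map z

variable (P P') in
/-- If the kernel of `P'` contains `W`, the functor `H'` factors through `𝓑 / W`. -/
noncomputable def HBar (hW : ∀ A, P.W A → P'.kernel A) : P.Quot ⥤ P'.Heart :=
  CategoryTheory.Quotient.lift P.rel P'.H fun _ _ _ _ ⟨_, i, p, hD, h⟩ =>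
    H_map_eq_of_kernel i p h (hW _ hD)

variable (P P') in
/-- `𝓑 ⥤ 𝓑 / W` followed by `HBar` is `H'`. -/
noncomputable def πCompHBarIso (hW : ∀ A, P.W A → P'.kernel A) : P.π ⋙ P.HBar P' hW ≅ P'.H :=
  CategoryTheory.Quotient.lift.isLift P.rel P'.H _

/-- `(H' restricted to the heart of P) ∘ H ≅ H'`, if the kernel of `P'` contains `U` and `V`. -/
lemma nonempty_H_comp_HBar (hU : ∀ A, P.U A → P'.kernel A) (hV : ∀ A, P.V A → P'.kernel A)
    (hW : ∀ A, P.W A → P'.kernel A) :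
    Nonempty (P.H ⋙ P.QHeart.ι ⋙ P.HBar P' hW ≅ P'.H) := by
  let F := P.HBar P' hW
  -- `α` and `β` are the images under `H'` of `B ⟶ B⁺` and `(B⁺)⁻ ⟶ B⁺`.
  let α : P.π ⋙ F ⟶ (P.π ⋙ P.sigmaPlus ⋙ P.QPlus.ι) ⋙ F :=
    Functor.whiskerRight (Functor.whiskerLeft P.π P.sigmaPlusAdj.unit) F
  let β : P.H ⋙ P.QHeart.ι ⋙ F ⟶ (P.π ⋙ P.sigmaPlus ⋙ P.QPlus.ι) ⋙ F :=
    Functor.whiskerRight (Functor.whiskerLeft (P.π ⋙ P.sigmaPlus ⋙ P.QPlus.ι)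
      P.sigmaMinusAdj.counit) F
  have hα : IsIso α := by
    rw [NatTrans.isIso_iff_isIso_app]
    intro B
    have := isIso_H_map_of_reflection (P.isReflectionSeq_plus B) hU
    have h : α.app B = P'.H.map (P.toPlus B) :=
      congrArg F.map (P.unit_app_sigmaPlusAdj (P.π.obj B))
    rw [h]
    exact this
  have hβ : IsIso β := by
    rw [NatTrans.isIso_iff_isIso_app]
    intro B
    have := isIso_H_map_of_coreflection (P.isCoreflectionSeq_minus (P.plus B)) hV
    have h : β.app B = P'.H.map (P.fromMinus (P.plus B)) :=
      congrArg F.map (P.counit_app_sigmaMinusAdj (P.π.obj (P.plus B)))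
    rw [h]
    exact this
  exact ⟨asIso β ≪≫ (asIso α).symm⟩

lemma isIso_unitMap {B : 𝓑} (hB : P.Bplus B) : IsIso (P.unitMap (P.π.obj B)) := by
  have hr := P.isReflectionSeq_plus B
  obtain ⟨g, hg⟩ := hr.exists_lift hB (𝟙 B)
  have : IsIso (P.π.map (P.toPlus B)) := by
    refine ⟨P.π.map g, ?_, ?_⟩
    · rwa [← Functor.map_comp, ← CategoryTheory.Functor.map_id, π_map_eq_iff]
    · rw [← Functor.map_comp, ← CategoryTheory.Functor.map_id, π_map_eq_iff]
      refine hr.factors hr.hZ _ ?_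
      simpa [Preadditive.comp_sub, Preadditive.sub_comp] using hg.postcomp (P.toPlus B)
  exact this

lemma isIso_counitMap {B : 𝓑} (hB : P.Bminus B) : IsIso (P.counitMap (P.π.obj B)) := by
  have hr := P.isCoreflectionSeq_minus B
  obtain ⟨g, hg⟩ := hr.exists_lift hB (𝟙 B)
  have : IsIso (P.π.map (P.fromMinus B)) := by
    refine ⟨P.π.map g, ?_, ?_⟩
    · rw [← Functor.map_comp, ← CategoryTheory.Functor.map_id, π_map_eq_iff]
      refine hr.factors hr.hZ _ ?_
      simpa [Preadditive.comp_sub, Preadditive.sub_comp] using hg.precomp (P.fromMinus B)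
    · rwa [← Functor.map_comp, ← CategoryTheory.Functor.map_id, π_map_eq_iff]
  exact this

variable (P) in
/-- The composite `σ⁻ ∘ σ⁺` is isomorphic to the identity on the heart. -/
lemma nonempty_sigma_heart :
    Nonempty (P.QHeart.ι ⋙ P.QHeart.lift (P.sigmaPlus ⋙ P.QPlus.ι ⋙ P.sigmaMinus ⋙ P.QMinus.ι)
      P.sigma_mem_heart ≅ 𝟭 P.Heart) := by
  let α : P.QHeart.ι ⟶ P.QHeart.ι ⋙ P.sigmaPlus ⋙ P.QPlus.ι :=
    Functor.whiskerLeft P.QHeart.ι P.sigmaPlusAdj.unit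
  let β : (P.QHeart.ι ⋙ P.sigmaPlus ⋙ P.QPlus.ι) ⋙ P.sigmaMinus ⋙ P.QMinus.ι ⟶
      P.QHeart.ι ⋙ P.sigmaPlus ⋙ P.QPlus.ι :=
    Functor.whiskerLeft (P.QHeart.ι ⋙ P.sigmaPlus ⋙ P.QPlus.ι) P.sigmaMinusAdj.counit
  have hα : IsIso α := by
    rw [NatTrans.isIso_iff_isIso_app]
    intro B
    have h : α.app B = P.unitMap B.obj := P.unit_app_sigmaPlusAdj _
    rw [h]
    exact isIso_unitMap B.property.1
  have hβ : IsIso β := by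
    rw [NatTrans.isIso_iff_isIso_app]
    intro B
    have h : β.app B = P.counitMap (P.π.obj (P.plus B.obj.as)) := P.counit_app_sigmaMinusAdj _
    rw [h]
    have hr := P.isReflectionSeq_plus B.obj.as
    obtain ⟨ρ, hρ⟩ := hr.conflation
    -- For `B` in the heart, `B⁺` stays in `𝓑⁻`, being an extension of `S ∈ U` by `B`.
    exact isIso_counitMap (Bminus_of_extension hρ B.property.2 hr.hS)
  exact ⟨P.QHeart.fullyFaithfulι.whiskeringRight _ |>.preimageIso (asIso β ≪≫ (asIso α).symm)⟩

/-! ### Comparison of the two hearts. -/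

/-- Both kernels are zero loci, and an equivalence preserves and reflects zero objects. -/
lemma kernel_eq_of_heartEquivalent (h : HeartEquivalent P P') : P.kernel = P'.kernel := by
  obtain ⟨e, ⟨α⟩⟩ := h
  funext B
  rw [eq_iff_iff, kernel_iff_isZero_H, kernel_iff_isZero_H]
  constructor
  · intro hB
    refine IsZero.of_iso ?_ (α.app B).symm
    exact IsZero.of_full_of_faithful_of_isZero e.inverse _ (hB.of_iso (e.unitIso.app _).symm)
  · intro hB
    exact IsZero.of_full_of_faithful_of_isZero e.functor _ (hB.of_iso (α.app B))

lemma heartEquivalent_of_kernel (hU : ∀ A, P.U A → P'.kernel A) (hV : ∀ A, P.V A → P'.kernel A)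
    (hU' : ∀ A, P'.U A → P.kernel A) (hV' : ∀ A, P'.V A → P.kernel A) : HeartEquivalent P P' := by
  have key : ∀ (P P' : CotorsionPair X) (hW : ∀ A, P.W A → P'.kernel A)
      (hW' : ∀ A, P'.W A → P.kernel A), (∀ A, P'.U A → P.kernel A) → (∀ A, P'.V A → P.kernel A) →
      Nonempty ((P.QHeart.ι ⋙ P.HBar P' hW) ⋙ P'.QHeart.ι ⋙ P'.HBar P hW' ≅ 𝟭 P.Heart) := by
    intro P P' hW hW' hU' hV'
    obtain ⟨α⟩ := nonempty_H_comp_HBar hU' hV' hW'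
    obtain ⟨β⟩ := P.nonempty_sigma_heart
    -- After precomposition with `π` the claim on `𝓑 / W` is that `H'` followed by the functor
    -- induced by `H` is `H`, which is `α`. It descends to the quotient, and restricting to the
    -- heart turns `σ⁻ ∘ σ⁺` into the identity.
    refine ⟨Functor.isoWhiskerLeft P.QHeart.ι
      (CategoryTheory.Quotient.natIsoLift P.rel (F := P.HBar P' hW ⋙ P'.QHeart.ι ⋙ P'.HBar P hW')
        (G := P.QHeart.lift (P.sigmaPlus ⋙ P.QPlus.ι ⋙ P.sigmaMinus ⋙ P.QMinus.ι)
          P.sigma_mem_heart) ?_) ≪≫ β⟩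
    exact Functor.isoWhiskerRight (P.πCompHBarIso P' hW)
      (P'.QHeart.ι ⋙ P'.HBar P hW') ≪≫ α
  have hW : ∀ A, P.W A → P'.kernel A := fun A h => hU A h.1
  have hW' : ∀ A, P'.W A → P.kernel A := fun A h => hU' A h.1
  obtain ⟨η⟩ := key P P' hW hW' hU' hV'
  obtain ⟨ε⟩ := key P' P hW' hW hU hV
  exact ⟨CategoryTheory.Equivalence.mk _ _ η.symm ε, nonempty_H_comp_HBar hU hV hW⟩

end CotorsionPair

end ExtriCat

theorem mainTheorem4 {𝓑 : Type u} [CategoryTheory.Category.{v} 𝓑]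
    [CategoryTheory.Preadditive 𝓑] [CategoryTheory.Limits.HasZeroObject 𝓑]
    [CategoryTheory.Limits.HasBinaryBiproducts 𝓑]
    (X : ExtriCat.ExtriangulatedCategory.{w} 𝓑) (P P' : ExtriCat.CotorsionPair X) :
    List.TFAE
      [ExtriCat.CotorsionPair.HeartEquivalent P P',
        (P'.HVanishesOn P.U ∧ P'.HVanishesOn P.V) ∧ (P.HVanishesOn P'.U ∧ P.HVanishesOn P'.V),
        P.kernel = P'.kernel] := by
  open ExtriCat.CotorsionPair in
  tfae_have 1 → 3 := kernel_eq_of_heartEquivalent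
  tfae_have 3 → 2 := fun h =>
    ⟨⟨fun B hB => isZero_H_of_kernel (h ▸ kernel_of_U hB),
      fun B hB => isZero_H_of_kernel (h ▸ kernel_of_V hB)⟩,
      fun B hB => isZero_H_of_kernel (h ▸ kernel_of_U hB),
      fun B hB => isZero_H_of_kernel (h ▸ kernel_of_V hB)⟩
  tfae_have 2 → 1 := fun ⟨⟨hU, hV⟩, hU', hV'⟩ =>
    heartEquivalent_of_kernel (fun A hA => kernel_of_isZero_H (hU A hA))
      (fun A hA => kernel_of_isZero_H (hV A hA)) (fun A hA => kernel_of_isZero_H (hU' A hA))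
      (fun A hA => kernel_of_isZero_H (hV' A hA))
  tfae_finish
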